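/- **Setting.** Let $X$ be the rooted $K$-ary tree, $K\ge 2$ (every vertex has exactly $K$ children), viewed as a metric graph with edges of length one; $|x|$ is the graph distance from $x\in X$ to the root, and $d|x|$ is the measure giving each edge Lebesgue measure one. For $\epsilon>0$ put $d_X(x,y)=\int_{[x,y]}e^{-\epsilon|z|}\,d|z|$, and let $ds_X=e^{-\epsilon|z|}\,d|z|$ be the corresponding arc length. The boundary $\partial X$ is the set of infinite geodesics $\xi$ from the root, with $d_X(\xi,\zeta)=\frac2\epsilon e^{-\epsilon k}$ if $k$ is the level of the last common vertex of $\xi\ne\zeta$. Let $\nu$ be an Ahlfors $Q$-regular Borel measure on $\partial X$ with $Q=\frac{\log K}{\epsilon}$, i.e. $\nu(B(\xi,r))\approx r^Q$ for all $\xi\in\partial X$, $0<r\le \operatorname{diam}\partial X$. For a vertex $x$ let $I_x\subset\partial X$ be the set of the geodesic rays $\xi$ that pass through $x$; $\mathscr Q_n=\{I_x:|x|=n\}$, $\widehat I\in\mathscr Q_{n-1}$ is the parent of $I\in\mathscr Q_n$, and $f_I=\nu(I)^{-1}\int_I f\,d\nu$. Let $\beta>\log K$, $\lambda\in\mathbb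 R$, fix $C\ge\max\{2|\lambda|/(\beta-\log K),\,2(\log 4)/\epsilon\}$ and let $d\mu_\lambda(x)=e^{-\beta|x|}(|x|+C)^\lambda\,d|x|$. The Newtonian space $N^{1,p}(X,\mu_\lambda)$ consists of all $u\in L^1_{\rm loc}(X,\mu_\lambda)$ with $$\|u\|_{N^{1,p}}=\Big(\int_X|u|^p\,d\mu_\lambda+\inf_g\int_X g^p\,d\mu_\lambda\Big)^{1/p}<\infty,$$ the infimum being over all upper gradients $g$ of $u$, i.e. Borel functions $g:X\to[0,\infty]$ with $|u(z)-u(y)|\le\int_{[z,y]}g\,ds_X$ for all $z,y\in X$. The space $\mathcal B^{0,\lambda}_p(\partial X)$ consists of all $f\in L^p(\partial X)$ with $$\|f\|_{\mathcal B^{0,\lambda}_p}=\|f\|_{L^p(\partial X)}+\Big(\sum_{n=1}^\infty n^\lambda\sum_{I\in\mathscr Q_n}\nu(I)\,|f_I-f_{\widehat I}|^p\Big)^{1/p}<\infty .$$ For $u\in L^1_{\rm loc}(\partial X)$ let $Eu:X\to\mathbb R$ be the function with $Eu(x)=u_{I_x}$ at each vertex $x$ which is affine with respect to $d_X$ on each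 edge. For $F:X\to\mathbb R$ let $TF(\xi)=\lim_{[0,\xi)\ni x\to\xi}F(x)$ be the trace (limit along the geodesic ray, for $\nu$-a.e. $\xi$). **Theorem 1.4.** Suppose that $p=(\beta-\log K)/\epsilon\ge 1$, and that $\lambda>p-1$ if $p>1$, or $\lambda\ge0$ if $p=1$. Then: 1. $E$ is a bounded linear operator from $\mathcal B^{0,\lambda}_p(\partial X)$ to $N^{1,p}(X,\mu_\lambda)$, and $T\circ E$ is the identity on $\mathcal B^{0,\lambda}_p(\partial X)$ (the limits exist and equal $u$ $\nu$-a.e.). 2. There is a constant $A$ such that $\|u\|_{\mathcal B^{0,\lambda}_p}\le A\|Eu\|_{N^{1,p}}$ and $\|Eu\|_{N^{1,p}}\le A\|u\|_{\mathcal B^{0,\lambda}_p}$ for all $u\in\mathcal B^{0,\lambda}_p(\partial X)$. 3. $\mathcal B^{0,\lambda}_p(\partial X)$ is optimal for $E$: if $\mathbb X\subset L^1_{\rm loc}(\partial X)$ is a Banach space (a linear subspace with a complete norm) such that $E:\mathbb X\to N^{1,p}(X,\mu_\lambda)$ is bounded and linear and $T\circ E$ is the identity on $\mathbb X$, then $\mathbb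 X\subset\mathcal B^{0,\lambda}_p(\partial X)$, and there is a constant $A$ with $\|f\|_{\mathcal B^{0,\lambda}_p}\le A\|f\|_{\mathbb X}$ for all $f\in\mathbb X$. -/

import Mathlib

open MeasureTheory Filter Topology Set
open scoped ENNReal NNReal

noncomputable section

namespace RegTree

/-! ### The `K`-ary tree as a metric graph, and its boundary -/

/-- The rooted `K`-ary tree, viewed as a metric graph with edges of length one. Vertices of level `n`
are the words of length `n` over `Fin K`: the root is the empty word and the `K` children of `v` are
the words `v ++ [a]`. A point `x` of the graph is given by its distance `height = |x|` to the root
and by the (unique) vertex `word`, of level `⌈|x|⌉`, such that `x` lies on the half-open edge from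
the parent of `word` (excluded) to `word` (included); for the root, `word = []`.
The parameter `ε` is that of the uniformizing metric, see `instMetricSpace`. -/
@[ext]
structure Tree (K : ℕ) (ε : ℝ) where
  /-- the graph distance `|x|` to the root -/
  height : ℝ
  /-- the lower end point of the edge that contains the point -/
  word : List (Fin K)
  height_nonneg : 0 ≤ height
  length_word : word.length = ⌈height⌉₊

/-- The boundary: infinite geodesics from the root, that is, infinite words. Its Borel `σ`-algebra is
the product `σ`-algebra. -/
abbrev Boundary (K : ℕ) : Type := ℕ → Fin K

variable {K : ℕ} {ε : ℝ}

/-- The length of the longest common prefix of two words. -/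
def commonLen : List (Fin K) → List (Fin K) → ℕ
  | a :: l, b :: l' => if a = b then commonLen l l' + 1 else 0
  | _, _ => 0

/-- The height of the last common point of the geodesics `[0, x]` and `[0, y]`. -/
def meet (x y : Tree K ε) : ℝ :=
  min (min x.height y.height) (commonLen x.word y.word)

/-- The uniformizing metric `d_X(x, y) = ∫_{[x,y]} e^{-ε|z|} d|z|`: the geodesic `[x, y]` runs from `x`
down to the last common point of `[0, x]` and `[0, y]`, and from there to `y`. -/
def treeDist (x y : Tree K ε) : ℝ :=
  (∫ t in (meet x y)..x.height, Real.exp (-ε * t)) +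
    ∫ t in (meet x y)..y.height, Real.exp (-ε * t)

theorem le_commonLen (l l' : List (Fin K)) (k : ℕ) :
    k ≤ commonLen l l' ↔ k ≤ l.length ∧ k ≤ l'.length ∧ l.take k = l'.take k := by
  induction l generalizing l' k with
  | nil => cases k <;> simp [commonLen]
  | cons a l ih =>
    cases l' with
    | nil => cases k <;> simp [commonLen]
    | cons b l' =>
      cases k with
      | zero => simp
      | succ k =>
        by_cases h : a = b
        · simp [commonLen, h, ih]
        · simp [commonLen, h]

theorem commonLen_comm (l l' : List (Fin K)) : commonLen l l' = commonLen l' l := by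
  apply le_antisymm
  · have h := (le_commonLen l l' _).1 le_rfl
    exact (le_commonLen l' l _).2 ⟨h.2.1, h.1, h.2.2.symm⟩
  · have h := (le_commonLen l' l _).1 le_rfl
    exact (le_commonLen l l' _).2 ⟨h.2.1, h.1, h.2.2.symm⟩

theorem commonLen_self (l : List (Fin K)) : commonLen l l = l.length :=
  le_antisymm ((le_commonLen l l _).1 le_rfl).1 ((le_commonLen l l _).2 ⟨le_rfl, le_rfl, rfl⟩)

theorem min_commonLen_le (l₁ l₂ l₃ : List (Fin K)) :
    min (commonLen l₁ l₂) (commonLen l₂ l₃) ≤ commonLen l₁ l₃ := by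
  have h := (le_commonLen l₁ l₂ _).1 (min_le_left (commonLen l₁ l₂) (commonLen l₂ l₃))
  have h' := (le_commonLen l₂ l₃ _).1 (min_le_right (commonLen l₁ l₂) (commonLen l₂ l₃))
  exact (le_commonLen _ _ _).2 ⟨h.1, h'.2.1, h.2.2.trans h'.2.2⟩

theorem meet_comm (x y : Tree K ε) : meet x y = meet y x := by
  simp only [meet, commonLen_comm x.word y.word, min_comm x.height]

theorem meet_le_left (x y : Tree K ε) : meet x y ≤ x.height :=
  (min_le_left _ _).trans (min_le_left _ _)

theorem meet_le_right (x y : Tree K ε) : meet x y ≤ y.height :=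
  (min_le_left _ _).trans (min_le_right _ _)

theorem meet_self (x : Tree K ε) : meet x x = x.height := by
  have h : x.height ≤ x.word.length := by rw [x.length_word]; exact Nat.le_ceil _
  simp [meet, commonLen_self, h]

theorem min_meet_le (x y z : Tree K ε) : min (meet x y) (meet y z) ≤ meet x z := by
  have h := min_commonLen_le x.word y.word z.word
  have h' : min (commonLen x.word y.word : ℝ) (commonLen y.word z.word) ≤
      commonLen x.word z.word := by exact_mod_cast h
  refine le_min (le_min ?_ ?_) (le_trans ?_ h')
  · exact (min_le_left _ _).trans (meet_le_left _ _)
  · exact (min_le_right _ _).trans (meet_le_right _ _)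
  · exact min_le_min (min_le_right _ _) (min_le_right _ _)

/-- The `d_X`-distance from the root to a point at height `t`. -/
def len (ε t : ℝ) : ℝ := ∫ s in (0 : ℝ)..t, Real.exp (-ε * s)

theorem integral_exp_eq (a b : ℝ) :
    ∫ s in a..b, Real.exp (-ε * s) = len ε b - len ε a := by
  have h : ∀ c d : ℝ, IntervalIntegrable (fun s => Real.exp (-ε * s)) volume c d :=
    fun c d => (by fun_prop : Continuous fun s => Real.exp (-ε * s)).intervalIntegrable c d
  rw [len, len, intervalIntegral.integral_interval_sub_left (h _ _) (h _ _)]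

theorem len_strictMono (ε : ℝ) : StrictMono (len ε) := by
  intro a b hab
  have h : 0 < ∫ s in a..b, Real.exp (-ε * s) :=
    intervalIntegral.intervalIntegral_pos_of_pos
      ((by fun_prop : Continuous fun s => Real.exp (-ε * s)).intervalIntegrable a b)
      (fun s => Real.exp_pos _) hab
  rw [integral_exp_eq] at h
  linarith

theorem continuous_len (ε : ℝ) : Continuous (len ε) :=
  intervalIntegral.continuous_primitive
    (fun a b => (by fun_prop : Continuous fun s => Real.exp (-ε * s)).intervalIntegrable a b) 0

theorem treeDist_eq (x y : Tree K ε) :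
    treeDist x y = len ε x.height + len ε y.height - 2 * len ε (meet x y) := by
  rw [treeDist, integral_exp_eq, integral_exp_eq]
  ring

instance instMetricSpace : MetricSpace (Tree K ε) where
  dist := treeDist
  dist_self x := by rw [treeDist_eq, meet_self]; ring
  dist_comm x y := by rw [treeDist_eq, treeDist_eq, meet_comm]; ring
  dist_triangle x y z := by
    rw [treeDist_eq, treeDist_eq, treeDist_eq]
    have hm := (len_strictMono ε).monotone
    have h1 := hm (min_meet_le x y z)
    have h2 := hm (meet_le_right x y)
    have h3 := hm (meet_le_left y z)
    rcases le_total (meet x y) (meet y z) with h | h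
    · rw [min_eq_left h] at h1; linarith
    · rw [min_eq_right h] at h1; linarith
  eq_of_dist_eq_zero := by
    intro x y h
    change treeDist x y = 0 at h
    rw [treeDist_eq] at h
    have hm := (len_strictMono ε).monotone
    have h1 := hm (meet_le_left x y)
    have h2 := hm (meet_le_right x y)
    have e1 : meet x y = x.height := (len_strictMono ε).injective (by linarith)
    have e2 : meet x y = y.height := (len_strictMono ε).injective (by linarith)
    have e3 : x.height ≤ commonLen x.word y.word := e1 ▸ min_le_right _ _
    have e4 : x.word.length ≤ commonLen x.word y.word := by
      rw [x.length_word]; exact Nat.ceil_le.2 e3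
    have e5 : y.word.length = x.word.length := by
      rw [x.length_word, y.length_word, ← e1, ← e2]
    have e6 := ((le_commonLen _ _ _).1 e4).2.2
    rw [List.take_length, ← e5, List.take_length] at e6
    exact Tree.ext (e1.symm.trans e2) e6

instance instMeasurableSpace : MeasurableSpace (Tree K ε) := borel _

instance instBorelSpace : BorelSpace (Tree K ε) := ⟨rfl⟩

/-- The vertex `v` as a point of the tree. -/
def vertex (ε : ℝ) (v : List (Fin K)) : Tree K ε where
  height := v.length
  word := v
  height_nonneg := by positivity
  length_word := by simp

/-- For `0 ≤ t ≤ |x|`, the point at height `t` of the geodesic `[0, x]` (for other `t`, the nearest end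
point of this geodesic). -/
def anc (x : Tree K ε) (t : ℝ) : Tree K ε where
  height := max 0 (min t x.height)
  word := x.word.take ⌈max 0 (min t x.height)⌉₊
  height_nonneg := le_max_left _ _
  length_word := by
    rw [List.length_take, x.length_word]
    exact min_eq_left (Nat.ceil_mono (max_le x.height_nonneg (min_le_right _ _)))

/-- For `t ≥ 0`, the point at height `t` of the geodesic ray `[0, ξ)`. -/
def ray (ε : ℝ) (ξ : Boundary K) (t : ℝ) : Tree K ε where
  height := max 0 t
  word := List.ofFn fun i : Fin ⌈max 0 t⌉₊ => ξ i
  height_nonneg := le_max_left _ _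
  length_word := by simp

theorem meet_anc_anc (x : Tree K ε) (s t : ℝ) :
    meet (anc x s) (anc x t) = min (anc x s).height (anc x t).height := by
  refine min_eq_left ?_
  have h : min (anc x s).word.length (anc x t).word.length ≤
      commonLen (anc x s).word (anc x t).word := by
    refine (le_commonLen _ _ _).2 ⟨min_le_left _ _, min_le_right _ _, ?_⟩
    simp only [anc, List.take_take, List.length_take]
    congr 1
    omega
  have h' : min ((anc x s).word.length : ℝ) ((anc x t).word.length) ≤
      commonLen (anc x s).word (anc x t).word := by exact_mod_cast h
  refine le_trans (min_le_min ?_ ?_) h'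
  · rw [(anc x s).length_word]; exact Nat.le_ceil _
  · rw [(anc x t).length_word]; exact Nat.le_ceil _

theorem continuous_anc (x : Tree K ε) : Continuous (anc x) := by
  have hc : Continuous fun t : ℝ => len ε (anc x t).height :=
    (continuous_len ε).comp (by simp only [anc]; fun_prop)
  have hd : ∀ s t, dist (anc x s) (anc x t) =
      dist (len ε (anc x s).height) (len ε (anc x t).height) := by
    intro s t
    change treeDist _ _ = _
    rw [treeDist_eq, meet_anc_anc, Real.dist_eq]
    have hm := (len_strictMono ε).monotone
    rcases le_total (anc x s).height (anc x t).height with h | h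
    · rw [min_eq_left h, abs_of_nonpos (sub_nonpos.2 (hm h))]; ring
    · rw [min_eq_right h, abs_of_nonneg (sub_nonneg.2 (hm h))]; ring
  rw [Metric.continuous_iff] at hc ⊢
  intro b e he
  obtain ⟨δ, hδ, h⟩ := hc b e he
  exact ⟨δ, hδ, fun a ha => by rw [hd]; exact h a ha⟩

theorem anc_vertex_word (x : Tree K ε) : anc (vertex ε x.word) x.height = x := by
  have h : max 0 (min x.height (x.word.length : ℝ)) = x.height := by
    rw [min_eq_left (by rw [x.length_word]; exact Nat.le_ceil _), max_eq_right x.height_nonneg]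
  refine Tree.ext h ?_
  change x.word.take ⌈max 0 (min x.height (x.word.length : ℝ))⌉₊ = x.word
  rw [h, ← x.length_word, List.take_length]

instance instSecondCountable : SecondCountableTopology (Tree K ε) := by
  have h : (univ : Set (Tree K ε)) = ⋃ v : List (Fin K), range (anc (vertex ε v)) :=
    Eq.symm <| eq_univ_of_forall fun x =>
      mem_iUnion.2 ⟨x.word, mem_range.2 ⟨x.height, anc_vertex_word x⟩⟩
  have h' : TopologicalSpace.IsSeparable (univ : Set (Tree K ε)) := by
    rw [h]
    exact TopologicalSpace.IsSeparable.iUnion fun v =>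
      TopologicalSpace.isSeparable_range (continuous_anc _)
  have := TopologicalSpace.isSeparable_univ_iff.1 h'
  exact UniformSpace.secondCountable_of_separable _

/-! ### Measures -/

/-- The measure `d|x|`, which gives each edge Lebesgue measure one: it is the sum over all vertices
`v` other than the root of Lebesgue measure on the edge that ends at `v`. -/
def edgeMeasure (K : ℕ) (ε : ℝ) : Measure (Tree K ε) :=
  Measure.sum fun v : {v : List (Fin K) // v ≠ []} =>
    (volume.restrict (Ioc ((v.1.length : ℝ) - 1) v.1.length)).map (anc (vertex ε v.1))

/-- `dμ_λ(x) = e^{-β|x|} (|x| + C)^λ d|x|`. -/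
def mu (K : ℕ) (ε β C lam : ℝ) : Measure (Tree K ε) :=
  (edgeMeasure K ε).withDensity fun x =>
    ENNReal.ofReal (Real.exp (-β * x.height) * (x.height + C) ^ lam)

open Classical in
/-- The visual metric on the boundary: `d_X(ξ, ζ) = 2 ∫_k^∞ e^{-εt} dt = (2/ε) e^{-εk}`, where `k` is
the level of the last common vertex of `ξ` and `ζ`. -/
def boundaryDist (ε : ℝ) (ξ ζ : Boundary K) : ℝ :=
  if ξ = ζ then 0 else 2 / ε * Real.exp (-ε * (PiNat.firstDiff ξ ζ : ℝ))

/-- Ahlfors `Q`-regularity of a Borel measure on the boundary: `ν(B(ξ, r)) ≈ r^Q` for all `ξ` and all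
`0 < r ≤ diam ∂X = 2/ε`. -/
def AhlforsRegular (ε Q : ℝ) (ν : Measure (Boundary K)) : Prop :=
  ∃ A : ℝ, 0 < A ∧ ∀ (ξ : Boundary K) (r : ℝ), 0 < r → r ≤ 2 / ε →
    ENNReal.ofReal (r ^ Q / A) ≤ ν {ζ | boundaryDist ε ξ ζ < r} ∧
      ν {ζ | boundaryDist ε ξ ζ < r} ≤ ENNReal.ofReal (A * r ^ Q)

/-! ### Newtonian spaces -/

/-- `∫_{[x,y]} g ds_X`, where `ds_X = e^{-ε|z|} d|z|` is arc length with respect to `d_X`. -/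
def geodesicIntegral (g : Tree K ε → ℝ≥0∞) (x y : Tree K ε) : ℝ≥0∞ :=
  (∫⁻ t in Ioc (meet x y) x.height, g (anc x t) * ENNReal.ofReal (Real.exp (-ε * t))) +
    ∫⁻ t in Ioc (meet x y) y.height, g (anc y t) * ENNReal.ofReal (Real.exp (-ε * t))

/-- `g` is an upper gradient of `u`. -/
def IsUpperGradient (u : Tree K ε → ℝ) (g : Tree K ε → ℝ≥0∞) : Prop :=
  Measurable g ∧ ∀ x y, ENNReal.ofReal |u x - u y| ≤ geodesicIntegral g x y

/-- `inf_g ∫ g^p dμ` over all upper gradients `g` of `u` (infinite if there is none). -/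
def gradEnergy (μ : Measure (Tree K ε)) (p : ℝ) (u : Tree K ε → ℝ) : ℝ≥0∞ :=
  ⨅ (g : Tree K ε → ℝ≥0∞) (_ : IsUpperGradient u g), ∫⁻ x, g x ^ p ∂μ

/-- `‖u‖_{N^{1,p}} = (∫ |u|^p dμ + inf_g ∫ g^p dμ)^{1/p}`, with values in `[0, ∞]`. -/
def newtonNorm (μ : Measure (Tree K ε)) (p : ℝ) (u : Tree K ε → ℝ) : ℝ≥0∞ :=
  ((∫⁻ x, ‖u x‖ₑ ^ p ∂μ) + gradEnergy μ p u) ^ (1 / p)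

theorem newtonNorm_lt_top {μ : Measure (Tree K ε)} {p : ℝ} (hp : 1 ≤ p) {u : Tree K ε → ℝ} :
    newtonNorm μ p u < ∞ ↔ (∫⁻ x, ‖u x‖ₑ ^ p ∂μ) < ∞ ∧
      ∃ g, IsUpperGradient u g ∧ (∫⁻ x, g x ^ p ∂μ) < ∞ := by
  have hp' : 0 < 1 / p := by positivity
  rw [newtonNorm, ENNReal.rpow_lt_top_iff_of_pos hp', ENNReal.add_lt_top, gradEnergy]
  simp only [iInf_lt_iff, exists_prop]

theorem geodesicIntegral_zero (x y : Tree K ε) :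
    geodesicIntegral (fun _ => 0) x y = 0 := by
  simp [geodesicIntegral]

theorem geodesicIntegral_add {g h : Tree K ε → ℝ≥0∞} (hg : Measurable g) (x y : Tree K ε) :
    geodesicIntegral (fun z => g z + h z) x y =
      geodesicIntegral g x y + geodesicIntegral h x y := by
  have hm : ∀ z : Tree K ε, Measurable fun t =>
      g (anc z t) * ENNReal.ofReal (Real.exp (-ε * t)) := fun z =>
    (hg.comp (continuous_anc z).measurable).mul (by fun_prop)
  simp only [geodesicIntegral, add_mul]
  rw [lintegral_add_left (hm x), lintegral_add_left (hm y)]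
  ring

theorem geodesicIntegral_const_mul {g : Tree K ε → ℝ≥0∞} (hg : Measurable g) (c : ℝ≥0∞)
    (x y : Tree K ε) :
    geodesicIntegral (fun z => c * g z) x y = c * geodesicIntegral g x y := by
  have hm : ∀ z : Tree K ε, Measurable fun t =>
      g (anc z t) * ENNReal.ofReal (Real.exp (-ε * t)) := fun z =>
    (hg.comp (continuous_anc z).measurable).mul (by fun_prop)
  simp only [geodesicIntegral, mul_assoc]
  rw [lintegral_const_mul c (hm x), lintegral_const_mul c (hm y)]
  ring

theorem lintegral_add_rpow_lt_top {α : Type*} [MeasurableSpace α] {μ : Measure α} {p : ℝ}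
    (hp : 1 ≤ p) {f g : α → ℝ≥0∞} (hf : AEMeasurable f μ) (hfi : (∫⁻ x, f x ^ p ∂μ) < ∞)
    (hgi : (∫⁻ x, g x ^ p ∂μ) < ∞) : (∫⁻ x, (f x + g x) ^ p ∂μ) < ∞ := by
  have h1 : (∫⁻ x, (f x + g x) ^ p ∂μ) ≤ ∫⁻ x, (2 : ℝ≥0∞) ^ (p - 1) * (f x ^ p + g x ^ p) ∂μ :=
    lintegral_mono fun x => ENNReal.rpow_add_le_mul_rpow_add_rpow _ _ hp
  have h2 : (2 : ℝ≥0∞) ^ (p - 1) ≠ ∞ := ENNReal.rpow_ne_top_of_nonneg (by linarith) (by simp)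
  rw [lintegral_const_mul' _ _ h2, lintegral_add_left' (hf.pow_const p)] at h1
  exact h1.trans_lt (ENNReal.mul_lt_top h2.lt_top (ENNReal.add_lt_top.2 ⟨hfi, hgi⟩))

/-- The Newtonian space `N^{1,p}(X, μ)`: the locally integrable functions of finite norm. -/
def newtonSpace (μ : Measure (Tree K ε)) (p : ℝ) (hp : 1 ≤ p) : Submodule ℝ (Tree K ε → ℝ) where
  carrier := {u | LocallyIntegrable u μ ∧ newtonNorm μ p u < ∞}
  zero_mem' := by
    have hp0 : 0 < p := by linarith
    refine ⟨locallyIntegrable_zero, (newtonNorm_lt_top hp).2 ⟨?_, fun _ => 0, ⟨?_, ?_⟩, ?_⟩⟩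
    · simp [ENNReal.zero_rpow_of_pos hp0]
    · fun_prop
    · intro x y; simp
    · simp [ENNReal.zero_rpow_of_pos hp0]
  add_mem' := by
    rintro u v ⟨hu, hu'⟩ ⟨hv, hv'⟩
    obtain ⟨hu1, g, hg, hg1⟩ := (newtonNorm_lt_top hp).1 hu'
    obtain ⟨hv1, h, hh, hh1⟩ := (newtonNorm_lt_top hp).1 hv'
    refine ⟨hu.add hv, (newtonNorm_lt_top hp).2 ⟨?_, fun z => g z + h z, ⟨?_, ?_⟩, ?_⟩⟩
    · refine lt_of_le_of_lt (lintegral_mono fun x => ?_)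
        (lintegral_add_rpow_lt_top hp hu.aestronglyMeasurable.enorm hu1 hv1)
      exact ENNReal.rpow_le_rpow (enorm_add_le _ _) (by linarith)
    · exact hg.1.add hh.1
    · intro x y
      rw [geodesicIntegral_add hg.1]
      refine le_trans ?_ (add_le_add (hg.2 x y) (hh.2 x y))
      rw [← ENNReal.ofReal_add (abs_nonneg _) (abs_nonneg _)]
      refine ENNReal.ofReal_le_ofReal ?_
      have : (u + v) x - (u + v) y = (u x - u y) + (v x - v y) := by
        simp only [Pi.add_apply]; ring
      rw [this]
      exact abs_add_le _ _
    · exact lintegral_add_rpow_lt_top hp hg.1.aemeasurable hg1 hh1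
  smul_mem' := by
    rintro c u ⟨hu, hu'⟩
    obtain ⟨hu1, g, hg, hg1⟩ := (newtonNorm_lt_top hp).1 hu'
    have hp0 : 0 ≤ p := by linarith
    have hc : ‖c‖ₑ ^ p ≠ ∞ := ENNReal.rpow_ne_top_of_nonneg hp0 enorm_ne_top
    refine ⟨hu.smul c, (newtonNorm_lt_top hp).2 ⟨?_, fun z => ‖c‖ₑ * g z, ⟨?_, ?_⟩, ?_⟩⟩
    · simp only [Pi.smul_apply, enorm_smul, ENNReal.mul_rpow_of_nonneg _ _ hp0]
      rw [lintegral_const_mul' _ _ hc]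
      exact ENNReal.mul_lt_top hc.lt_top hu1
    · exact hg.1.const_mul _
    · intro x y
      rw [geodesicIntegral_const_mul hg.1]
      refine le_trans (le_of_eq ?_) (mul_le_mul_right (hg.2 x y) _)
      simp only [Pi.smul_apply, smul_eq_mul, ← mul_sub, abs_mul]
      rw [ENNReal.ofReal_mul (abs_nonneg _), ← Real.norm_eq_abs c, ofReal_norm]
    · simp only [ENNReal.mul_rpow_of_nonneg _ _ hp0]
      rw [lintegral_const_mul' _ _ hc]
      exact ENNReal.mul_lt_top hc.lt_top hg1

/-! ### Besov-type spaces -/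

/-- `I_x` for the vertex `x` given by the word `v`: the rays `[0, ξ)` that pass through `x`. -/
def cyl (v : List (Fin K)) : Set (Boundary K) :=
  {ξ | ∀ (i : ℕ) (h : i < v.length), ξ i = v[i]}

/-- The mean value of `f` over `I_x`. -/
def mean (ν : Measure (Boundary K)) (f : Boundary K → ℝ) (v : List (Fin K)) : ℝ :=
  ⨍ ξ in cyl v, f ξ ∂ν

/-- The `p`-th power of the dyadic energy,
`∑_{n ≥ 1} e^{εnθp} n^λ ∑_{I ∈ Q_n} ν(I) |f_I - f_Î|^p`, with values in `[0, ∞]`. -/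
def besovEnergy (ε θ lam p : ℝ) (ν : Measure (Boundary K)) (f : Boundary K → ℝ) : ℝ≥0∞ :=
  ∑' m : ℕ, ENNReal.ofReal (Real.exp (ε * ((m + 1 : ℕ) : ℝ) * θ * p) * ((m + 1 : ℕ) : ℝ) ^ lam) *
    ∑ v : Fin (m + 1) → Fin K,
      ν (cyl (List.ofFn v)) *
        ‖mean ν f (List.ofFn v) - mean ν f (List.ofFn v).dropLast‖ₑ ^ p

/-- The norm of the Besov-type space, with values in `[0, ∞]`. -/
def besovNorm (ε θ lam p : ℝ) (ν : Measure (Boundary K)) (f : Boundary K → ℝ) : ℝ≥0∞ :=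
  eLpNorm f (ENNReal.ofReal p) ν + besovEnergy ε θ lam p ν f ^ (1 / p)

theorem besovNorm_lt_top {θ lam p : ℝ} (hp : 1 ≤ p) {ν : Measure (Boundary K)}
    {f : Boundary K → ℝ} : besovNorm ε θ lam p ν f < ∞ ↔
      eLpNorm f (ENNReal.ofReal p) ν < ∞ ∧ besovEnergy ε θ lam p ν f < ∞ := by
  have hp' : 0 < 1 / p := by positivity
  rw [besovNorm, ENNReal.add_lt_top, ENNReal.rpow_lt_top_iff_of_pos hp']

theorem mean_congr {ν : Measure (Boundary K)} {f g : Boundary K → ℝ} (h : f =ᵐ[ν] g)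
    (v : List (Fin K)) : mean ν f v = mean ν g v :=
  average_congr (ae_restrict_of_ae h)

theorem mean_add {ν : Measure (Boundary K)} {f g : Boundary K → ℝ}
    (hf : LocallyIntegrable f ν) (hg : LocallyIntegrable g ν) (v : List (Fin K)) :
    mean ν (f + g) v = mean ν f v + mean ν g v := by
  have hf' := (integrableOn_univ.1 (hf.integrableOn_isCompact isCompact_univ)).integrableOn (s := cyl v)
  have hg' := (integrableOn_univ.1 (hg.integrableOn_isCompact isCompact_univ)).integrableOn (s := cyl v)
  simp only [mean, setAverage_eq, Pi.add_apply]
  rw [integral_add hf' hg', smul_add]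

theorem mean_smul {ν : Measure (Boundary K)} (c : ℝ) (f : Boundary K → ℝ) (v : List (Fin K)) :
    mean ν (c • f) v = c * mean ν f v := by
  simp only [mean, setAverage_eq, Pi.smul_apply, smul_eq_mul]
  rw [integral_const_mul]
  ring

theorem besovEnergy_congr {θ lam p : ℝ} {ν : Measure (Boundary K)} {f g : Boundary K → ℝ}
    (h : f =ᵐ[ν] g) : besovEnergy ε θ lam p ν f = besovEnergy ε θ lam p ν g := by
  simp only [besovEnergy, mean_congr h]

theorem besovEnergy_add_le {θ lam p : ℝ} (hp : 1 ≤ p) {ν : Measure (Boundary K)}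
    {f g : Boundary K → ℝ} (hf : LocallyIntegrable f ν) (hg : LocallyIntegrable g ν) :
    besovEnergy ε θ lam p ν (f + g) ≤
      2 ^ (p - 1) * (besovEnergy ε θ lam p ν f + besovEnergy ε θ lam p ν g) := by
  simp only [besovEnergy]
  rw [← ENNReal.tsum_add, ← ENNReal.tsum_mul_left]
  refine ENNReal.tsum_le_tsum fun m => ?_
  rw [← mul_add, ← Finset.sum_add_distrib, mul_left_comm,
    Finset.mul_sum _ _ ((2 : ℝ≥0∞) ^ (p - 1))]
  refine mul_le_mul_right (Finset.sum_le_sum fun v _ => ?_) _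
  rw [mean_add hf hg, mean_add hf hg, ← mul_add, mul_left_comm]
  gcongr
  refine le_trans ?_ (ENNReal.rpow_add_le_mul_rpow_add_rpow _ _ hp)
  rw [add_sub_add_comm]
  exact ENNReal.rpow_le_rpow (enorm_add_le _ _) (by linarith)

theorem besovEnergy_smul {θ lam p : ℝ} (hp : 1 ≤ p) {ν : Measure (Boundary K)} (c : ℝ)
    (f : Boundary K → ℝ) :
    besovEnergy ε θ lam p ν (c • f) = ‖c‖ₑ ^ p * besovEnergy ε θ lam p ν f := by
  simp only [besovEnergy]
  rw [← ENNReal.tsum_mul_left]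
  refine tsum_congr fun m => ?_
  rw [mul_left_comm, Finset.mul_sum _ _ (‖c‖ₑ ^ p)]
  refine congrArg _ (Finset.sum_congr rfl fun v _ => ?_)
  rw [mean_smul, mean_smul, ← mul_sub, enorm_mul, ENNReal.mul_rpow_of_nonneg _ _ (by linarith)]
  ring

/-- The Besov-type space `B^{θ,λ}_p(∂X)`, for `1 ≤ p < ∞`, as a space of classes of functions modulo
equality `ν`-almost everywhere. -/
def besovSpace (ε θ lam p : ℝ) (hp : 1 ≤ p) (ν : Measure (Boundary K)) :
    Submodule ℝ (Boundary K →ₘ[ν] ℝ) where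
  carrier := {f | LocallyIntegrable f ν ∧ besovNorm ε θ lam p ν f < ∞}
  zero_mem' := by
    have h0 : ((0 : Boundary K →ₘ[ν] ℝ) : Boundary K → ℝ) =ᵐ[ν] (0 : ℝ) • (0 : Boundary K → ℝ) := by
      rw [zero_smul]; exact AEEqFun.coeFn_zero
    refine ⟨(locallyIntegrable_congr h0).2 ?_, (besovNorm_lt_top hp).2 ⟨?_, ?_⟩⟩
    · rw [zero_smul]; exact locallyIntegrable_zero
    · rw [eLpNorm_congr_ae h0]; simp
    · rw [besovEnergy_congr h0, besovEnergy_smul hp]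
      simp [ENNReal.zero_rpow_of_pos (show 0 < p by linarith)]
  add_mem' := by
    rintro f g ⟨hf, hf'⟩ ⟨hg, hg'⟩
    rw [besovNorm_lt_top hp] at hf' hg'
    have h := AEEqFun.coeFn_add f g
    refine ⟨(locallyIntegrable_congr h).2 (hf.add hg), (besovNorm_lt_top hp).2 ⟨?_, ?_⟩⟩
    · rw [eLpNorm_congr_ae h]
      exact eLpNorm_add_lt_top ⟨f.aestronglyMeasurable, hf'.1⟩ ⟨g.aestronglyMeasurable, hg'.1⟩
    · rw [besovEnergy_congr h]
      refine (besovEnergy_add_le hp hf hg).trans_lt (ENNReal.mul_lt_top ?_ ?_)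
      · exact (ENNReal.rpow_ne_top_of_nonneg (by linarith) (by simp)).lt_top
      · exact ENNReal.add_lt_top.2 ⟨hf'.2, hg'.2⟩
  smul_mem' := by
    rintro c f ⟨hf, hf'⟩
    rw [besovNorm_lt_top hp] at hf'
    have h := AEEqFun.coeFn_smul c f
    refine ⟨(locallyIntegrable_congr h).2 (hf.smul c), (besovNorm_lt_top hp).2 ⟨?_, ?_⟩⟩
    · rw [eLpNorm_congr_ae h]
      exact (MemLp.const_smul ⟨f.aestronglyMeasurable, hf'.1⟩ c).2
    · rw [besovEnergy_congr h, besovEnergy_smul hp]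
      exact ENNReal.mul_lt_top
        (ENNReal.rpow_ne_top_of_nonneg (by linarith) enorm_ne_top).lt_top hf'.2

/-! ### Trace and extension -/

/-- `g` is the trace of `F`: for `ν`-almost every `ξ`, the function `F` has the limit `g ξ` along the
geodesic ray `[0, ξ)`. -/
def IsTrace (ν : Measure (Boundary K)) (F : Tree K ε → ℝ) (g : Boundary K → ℝ) : Prop :=
  ∀ᵐ ξ ∂ν, Tendsto (fun t => F (ray ε ξ t)) atTop (𝓝 (g ξ))

/-- The Whitney-type extension `Eu`: its value at a vertex `x` is the mean value of `u` over `I_x`, and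
it is affine with respect to `d_X` on the edges. (If `t` is the root then `t.word.dropLast = t.word`,
and the value is the mean value of `u` over the boundary.) -/
def whitney (ε : ℝ) (ν : Measure (Boundary K)) (u : Boundary K → ℝ) (t : Tree K ε) : ℝ :=
  mean ν u t.word.dropLast +
    (mean ν u t.word - mean ν u t.word.dropLast) /
        dist (vertex ε t.word.dropLast) (vertex ε t.word) *
      dist (vertex ε t.word.dropLast) t

/-- Let `ι : V → L⁰(∂X)` be the inclusion of a vector space of classes of functions, and `N` a norm on
`V`. The proposition says that `E` is a bounded linear operator from `V` to `N^{1,p}(X, μ)` and that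
`T ∘ E` is the identity on `V`. -/
def IsBoundedLinearExtension (μ : Measure (Tree K ε)) (p : ℝ) (hp : 1 ≤ p)
    (ν : Measure (Boundary K)) {V : Type*} [AddCommGroup V] [Module ℝ V]
    (ι : V →ₗ[ℝ] (Boundary K →ₘ[ν] ℝ)) (N : V → ℝ≥0∞) : Prop :=
  (∃ E : V →ₗ[ℝ] newtonSpace μ p hp,
    (∀ f, (E f : Tree K ε → ℝ) = whitney ε ν (ι f)) ∧
      ∃ A : ℝ≥0, ∀ f, newtonNorm μ p (E f : Tree K ε → ℝ) ≤ A * N f) ∧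
    ∀ f, IsTrace ν (whitney ε ν (ι f)) (ι f)

end RegTree

end

/-! The extension `Eu` is affine with respect to `d_X` on the edge that ends at a vertex `w` of level
`n ≥ 1`, and changes there by `u_I - u_Î`, where `I = I_w`. That edge has `d_X`-length `≈ e^{-εn}`
and `μ_λ`-mass `≈ e^{-βn} n^λ`, and Ahlfors regularity gives `ν(I) ≈ K^{-n}`. Since
`εp = β - log K`, an upper gradient that is constant on the edge costs
`≈ e^{-βn} n^λ (e^{εn} |u_I - u_Î|)^p ≈ n^λ ν(I) |u_I - u_Î|^p`, which is the term of `I` in the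
Besov energy. The slope of `Eu` is an upper gradient (`isUpperGradient_slope`), and by Jensen's
inequality no other one does better up to a constant; so the gradient energy of `Eu` and the Besov
energy of `u` are comparable (`exists_gradEnergy_whitney_le`, `exists_besovEnergy_le_gradEnergy`).

For the `L^p` parts, Jensen's inequality for the means and `∑ e^{-(β - log K)n} n^λ < ∞` bound
`∫ |Eu|^p dμ_λ` by `∫ |u|^p dν` (`exists_lintegral_whitney_rpow_le`). Conversely, the means of `u`
over the cylinders around `ξ` are a martingale, so they converge to `u(ξ)` for almost every `ξ`
(`ae_tendsto_mean_pre`); this is also what identifies the trace of `Eu`. Hence `|u(ξ)|` is at most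
the mean at the root plus the sum of the successive differences, and Hölder's inequality against the
weight `n^λ`, which requires `λ > p - 1`, or `λ ≥ 0` if `p = 1`, bounds `‖u‖_p` by the mean at the
root and the Besov energy (`exists_lintegral_enorm_rpow_le`). The mean at the root is read off from
`Eu` on an edge at the root (`exists_enorm_mean_nil_rpow_le`).

The lower bound `‖u‖_B ≤ A ‖Eu‖_N` (`exists_besovNorm_le_newtonNorm`) holds for every integrable `u`,
not only for those in the Besov space. Optimality is an immediate consequence. -/

noncomputable section

namespace RegTree

variable {K : ℕ} {ε : ℝ}

/-! ### Two inequalities for powers of sums and integrals -/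

theorem lintegral_rpow_le_measure_univ_rpow_mul {α : Type*} [MeasurableSpace α] {μ : Measure α}
    {p : ℝ} (hp : 1 ≤ p) {f : α → ℝ≥0∞} (hf : AEMeasurable f μ) :
    (∫⁻ x, f x ∂μ) ^ p ≤ μ univ ^ (p - 1) * ∫⁻ x, f x ^ p ∂μ := by
  have hp0 : 0 < p := by linarith
  rcases hp.eq_or_lt with rfl | hp1
  · simp
  have h := ENNReal.lintegral_mul_le_Lp_mul_Lq μ (Real.HolderConjugate.conjExponent hp1) hf
    (aemeasurable_const (b := (1 : ℝ≥0∞)))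
  simp only [Pi.mul_apply, mul_one, ENNReal.one_rpow, lintegral_const, one_mul] at h
  refine (ENNReal.rpow_le_rpow h hp0.le).trans (le_of_eq ?_)
  rw [ENNReal.mul_rpow_of_nonneg _ _ hp0.le, ← ENNReal.rpow_mul, ← ENNReal.rpow_mul,
    one_div_mul_cancel hp0.ne', ENNReal.rpow_one, mul_comm, Real.conjExponent]
  congr 2
  field_simp

/-- Hölder's inequality against the weight `n ^ λ`. The condition on `λ` says exactly that
`n ^ (-λ / p)` is summable with the exponent conjugate to `p`. -/
theorem exists_tsum_rpow_le_weighted {p lam : ℝ} (hlam : (1 < p ∧ p - 1 < lam) ∨ (p = 1 ∧ 0 ≤ lam)) :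
    ∃ c : ℝ≥0, ∀ x : ℕ → ℝ≥0∞,
      (∑' m, x m) ^ p ≤ c * ∑' m : ℕ, ENNReal.ofReal (((m + 1 : ℕ) : ℝ) ^ lam) * x m ^ p := by
  rcases hlam with ⟨hp, hl⟩ | ⟨rfl, hl⟩
  · have hp0 : 0 < p := by linarith
    set q := Real.conjExponent p with hq
    have hpq : p.HolderConjugate q := Real.HolderConjugate.conjExponent hp
    have hq' : lam / p * q = lam / (p - 1) := by rw [hq, Real.conjExponent]; field_simp
    have hs : Summable fun m : ℕ => 1 / ((m + 1 : ℕ) : ℝ) ^ (lam / (p - 1)) :=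
      (summable_nat_add_iff 1).2
        (Real.summable_one_div_nat_rpow.2 ((one_lt_div (by linarith)).2 hl))
    have hfin : (∑' m : ℕ, ENNReal.ofReal (((m + 1 : ℕ) : ℝ) ^ (-(lam / p))) ^ q) ≠ ∞ := by
      refine ne_of_eq_of_ne (tsum_congr fun m => ?_) hs.tsum_ofReal_ne_top
      have hm : (0 : ℝ) < ((m + 1 : ℕ) : ℝ) := by positivity
      rw [ENNReal.ofReal_rpow_of_pos (by positivity), ← Real.rpow_mul hm.le, neg_mul, hq',
        Real.rpow_neg hm.le, one_div]
    refine ⟨(((∑' m : ℕ, ENNReal.ofReal (((m + 1 : ℕ) : ℝ) ^ (-(lam / p))) ^ q) ^ (1 / q)) ^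
      p).toNNReal, fun x => ?_⟩
    rw [ENNReal.coe_toNNReal (ENNReal.rpow_ne_top_of_nonneg hp0.le
      (ENNReal.rpow_ne_top_of_nonneg (by simpa using hpq.symm.nonneg) hfin))]
    have h := ENNReal.lintegral_mul_le_Lp_mul_Lq Measure.count hpq
      (f := fun m : ℕ => ENNReal.ofReal (((m + 1 : ℕ) : ℝ) ^ (lam / p)) * x m)
      (g := fun m : ℕ => ENNReal.ofReal (((m + 1 : ℕ) : ℝ) ^ (-(lam / p))))
      (measurable_of_countable _).aemeasurable (measurable_of_countable _).aemeasurable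
    simp only [lintegral_count, Pi.mul_apply] at h
    have e1 : ∀ m : ℕ, ENNReal.ofReal (((m + 1 : ℕ) : ℝ) ^ (lam / p)) * x m *
        ENNReal.ofReal (((m + 1 : ℕ) : ℝ) ^ (-(lam / p))) = x m := fun m => by
      have hm : (0 : ℝ) < ((m + 1 : ℕ) : ℝ) := by positivity
      rw [mul_right_comm, ← ENNReal.ofReal_mul (by positivity), ← Real.rpow_add hm,
        add_neg_cancel, Real.rpow_zero, ENNReal.ofReal_one, one_mul]
    have e2 : ∀ m : ℕ, (ENNReal.ofReal (((m + 1 : ℕ) : ℝ) ^ (lam / p)) * x m) ^ p =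
        ENNReal.ofReal (((m + 1 : ℕ) : ℝ) ^ lam) * x m ^ p := fun m => by
      have hm : (0 : ℝ) < ((m + 1 : ℕ) : ℝ) := by positivity
      rw [ENNReal.mul_rpow_of_nonneg _ _ hp0.le, ENNReal.ofReal_rpow_of_pos (by positivity),
        ← Real.rpow_mul hm.le, div_mul_cancel₀ _ hp0.ne']
    simp only [e1, e2] at h
    refine (ENNReal.rpow_le_rpow h hp0.le).trans (le_of_eq ?_)
    rw [ENNReal.mul_rpow_of_nonneg _ _ hp0.le, ← ENNReal.rpow_mul _ (1 / p),
      one_div_mul_cancel hp0.ne', ENNReal.rpow_one, mul_comm]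
  · refine ⟨1, fun x => ?_⟩
    simp only [ENNReal.rpow_one, ENNReal.coe_one, one_mul]
    refine ENNReal.tsum_le_tsum fun m => le_mul_of_one_le_left' ?_
    rw [ENNReal.one_le_ofReal]
    exact Real.one_le_rpow (by simp) hl

/-! ### Cylinders and conditional means on the boundary -/

/-- The vertex of level `n` on the geodesic ray `[0, ξ)`. -/
def pre (ξ : Boundary K) (n : ℕ) : List (Fin K) := List.ofFn fun i : Fin n => ξ i

@[simp] theorem length_pre (ξ : Boundary K) (n : ℕ) : (pre ξ n).length = n := by simp [pre]

theorem take_pre (ξ : Boundary K) {k n : ℕ} (h : k ≤ n) : (pre ξ n).take k = pre ξ k := by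
  apply List.ext_getElem <;> simp [pre, h]

theorem dropLast_pre (ξ : Boundary K) (n : ℕ) : (pre ξ (n + 1)).dropLast = pre ξ n := by
  rw [List.dropLast_eq_take, length_pre, Nat.add_sub_cancel, take_pre ξ n.le_succ]

theorem mem_cyl_ofFn {n : ℕ} {v : Fin n → Fin K} {ξ : Boundary K} :
    ξ ∈ cyl (List.ofFn v) ↔ (fun i : Fin n => ξ i) = v := by
  simp [cyl, funext_iff, Fin.forall_iff]

theorem measurable_restrict (K n : ℕ) :
    Measurable fun (ξ : Boundary K) (i : Fin n) => ξ i := by fun_prop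

theorem cyl_ofFn {n : ℕ} (v : Fin n → Fin K) :
    cyl (List.ofFn v) = (fun (ξ : Boundary K) (i : Fin n) => ξ i) ⁻¹' {v} := by
  ext ξ; exact mem_cyl_ofFn

theorem measurableSet_cyl (v : List (Fin K)) : MeasurableSet (cyl v) := by
  rw [← List.ofFn_get v, cyl_ofFn]
  exact measurable_restrict K _ (measurableSet_singleton _)

theorem pairwise_disjoint_cyl_ofFn (n : ℕ) :
    Pairwise (Function.onFun Disjoint fun v : Fin n → Fin K => cyl (List.ofFn v)) := by
  intro v w h
  refine Set.disjoint_left.2 fun ξ h1 h2 => h ?_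
  rw [← mem_cyl_ofFn.1 h1, mem_cyl_ofFn.1 h2]

theorem iUnion_cyl_ofFn (K n : ℕ) : ⋃ v : Fin n → Fin K, cyl (List.ofFn v) = univ :=
  eq_univ_of_forall fun _ => mem_iUnion.2 ⟨_, mem_cyl_ofFn.2 rfl⟩

theorem lintegral_eq_sum_cyl (ν : Measure (Boundary K)) (n : ℕ) (f : Boundary K → ℝ≥0∞) :
    ∫⁻ ξ, f ξ ∂ν = ∑ v : Fin n → Fin K, ∫⁻ ξ in cyl (List.ofFn v), f ξ ∂ν := by
  rw [← setLIntegral_univ, ← iUnion_cyl_ofFn K n,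
    lintegral_iUnion (fun v => measurableSet_cyl _) (pairwise_disjoint_cyl_ofFn n), tsum_fintype]

theorem measurable_comp_pre {α : Type*} [MeasurableSpace α] (F : List (Fin K) → α) (n : ℕ) :
    Measurable fun ξ : Boundary K => F (pre ξ n) :=
  (measurable_of_countable fun v : Fin n → Fin K => F (List.ofFn v)).comp (measurable_restrict K n)

theorem lintegral_comp_pre (ν : Measure (Boundary K)) (n : ℕ) (F : List (Fin K) → ℝ≥0∞) :
    ∫⁻ ξ, F (pre ξ n) ∂ν =
      ∑ v : Fin n → Fin K, ν (cyl (List.ofFn v)) * F (List.ofFn v) := by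
  rw [lintegral_eq_sum_cyl ν n]
  refine Finset.sum_congr rfl fun v _ => ?_
  have h : ∀ ξ ∈ cyl (List.ofFn v), F (pre ξ n) = F (List.ofFn v) := fun ξ hξ => by
    rw [pre, mem_cyl_ofFn.1 hξ]
  rw [setLIntegral_congr_fun (measurableSet_cyl _) h, setLIntegral_const, mul_comm]

theorem measure_cyl_mul_enorm_mean_rpow_le {ν : Measure (Boundary K)} [IsFiniteMeasure ν] {p : ℝ}
    (hp : 1 ≤ p) {u : Boundary K → ℝ} (hu : AEStronglyMeasurable u ν) (v : List (Fin K)) :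
    ν (cyl v) * ‖mean ν u v‖ₑ ^ p ≤ ∫⁻ ξ in cyl v, ‖u ξ‖ₑ ^ p ∂ν := by
  have hp0 : 0 < p := by linarith
  rcases eq_or_ne (ν (cyl v)) 0 with h0 | h0
  · simp [h0]
  have ht := measure_ne_top ν (cyl v)
  have h1 : ‖mean ν u v‖ₑ ≤ (ν (cyl v))⁻¹ * ∫⁻ ξ in cyl v, ‖u ξ‖ₑ ∂ν := by
    rw [mean, setAverage_eq, enorm_smul,
      enorm_inv (by simp [Measure.real, ENNReal.toReal_eq_zero_iff, h0, ht]),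
      Measure.real, Real.enorm_eq_ofReal ENNReal.toReal_nonneg, ENNReal.ofReal_toReal ht]
    gcongr
    exact enorm_integral_le_lintegral_enorm _
  calc ν (cyl v) * ‖mean ν u v‖ₑ ^ p
      ≤ ν (cyl v) * ((ν (cyl v))⁻¹ * ∫⁻ ξ in cyl v, ‖u ξ‖ₑ ∂ν) ^ p := by gcongr
    _ ≤ ν (cyl v) * ((ν (cyl v))⁻¹ ^ p *
          (ν (cyl v) ^ (p - 1) * ∫⁻ ξ in cyl v, ‖u ξ‖ₑ ^ p ∂ν)) := by
        rw [ENNReal.mul_rpow_of_nonneg _ _ hp0.le]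
        gcongr
        simpa using lintegral_rpow_le_measure_univ_rpow_mul hp (μ := ν.restrict (cyl v))
          hu.restrict.enorm
    _ = ∫⁻ ξ in cyl v, ‖u ξ‖ₑ ^ p ∂ν := by
        rw [← mul_assoc, ← mul_assoc, ENNReal.rpow_sub _ _ h0 ht, ENNReal.rpow_one,
          ENNReal.inv_rpow, div_eq_mul_inv]
        have h2 : ν (cyl v) ^ p ≠ 0 := by simp [h0, ht]
        have h3 : ν (cyl v) ^ p ≠ ∞ := ENNReal.rpow_ne_top_of_nonneg hp0.le ht
        rw [show ν (cyl v) * (ν (cyl v) ^ p)⁻¹ * (ν (cyl v) ^ p * (ν (cyl v))⁻¹) =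
          (ν (cyl v) * (ν (cyl v))⁻¹) * (ν (cyl v) ^ p * (ν (cyl v) ^ p)⁻¹) by ring,
          ENNReal.mul_inv_cancel h0 ht, ENNReal.mul_inv_cancel h2 h3]
        simp

theorem lintegral_enorm_mean_pre_rpow_le {ν : Measure (Boundary K)} [IsFiniteMeasure ν] {p : ℝ}
    (hp : 1 ≤ p) {u : Boundary K → ℝ} (hu : AEStronglyMeasurable u ν) (n : ℕ) :
    ∫⁻ ξ, ‖mean ν u (pre ξ n)‖ₑ ^ p ∂ν ≤ ∫⁻ ξ, ‖u ξ‖ₑ ^ p ∂ν := by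
  rw [lintegral_comp_pre ν n fun w => ‖mean ν u w‖ₑ ^ p, lintegral_eq_sum_cyl ν n]
  exact Finset.sum_le_sum fun v _ => measure_cyl_mul_enorm_mean_rpow_le hp hu _

/-- The Besov energy of smoothness `θ = 0` in terms of the martingale of the means. -/
theorem besovEnergy_zero_eq (ε lam p : ℝ) (ν : Measure (Boundary K)) (u : Boundary K → ℝ) :
    besovEnergy ε 0 lam p ν u = ∑' m : ℕ, ENNReal.ofReal (((m + 1 : ℕ) : ℝ) ^ lam) *
      ∫⁻ ξ, ‖mean ν u (pre ξ (m + 1)) - mean ν u (pre ξ m)‖ₑ ^ p ∂ν := by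
  refine tsum_congr fun m => ?_
  rw [← lintegral_comp_pre ν (m + 1) fun w => ‖mean ν u w - mean ν u w.dropLast‖ₑ ^ p]
  simp only [dropLast_pre]
  simp

/-! ### Convergence of the means along almost every ray -/

/-- The filtration of the boundary generated by the first `n` letters of a word. -/
def cylFiltration (K : ℕ) : Filtration ℕ (inferInstance : MeasurableSpace (Boundary K)) where
  seq n := MeasurableSpace.comap (fun (ξ : Boundary K) (i : Fin n) => ξ i) inferInstance
  mono' := by
    intro m n hmn
    refine Measurable.comap_le ?_
    refine @measurable_pi_lambda _ _ _ (_) _ _ fun i => ?_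
    exact (measurable_pi_apply (Fin.castLE hmn i)).comp
      (comap_measurable fun (ξ : Boundary K) (i : Fin n) => ξ i)
  le' n := (measurable_restrict K n).comap_le

theorem iSup_cylFiltration (K : ℕ) :
    ⨆ n, cylFiltration K n = (inferInstance : MeasurableSpace (Boundary K)) := by
  refine le_antisymm (iSup_le (cylFiltration K).le) (iSup_le fun i => ?_)
  refine le_trans (Measurable.comap_le ?_) (le_iSup (cylFiltration K) (i + 1))
  exact (measurable_pi_apply (Fin.last i)).comp
    (comap_measurable fun (ξ : Boundary K) (j : Fin (i + 1)) => ξ j)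

theorem mean_pre_ae_eq_condExp {ν : Measure (Boundary K)} [IsFiniteMeasure ν]
    {u : Boundary K → ℝ} (hu : Integrable u ν) (n : ℕ) :
    (fun ξ => mean ν u (pre ξ n)) =ᵐ[ν] ν[u | cylFiltration K n] := by
  have hi : Integrable (fun ξ => mean ν u (pre ξ n)) ν :=
    (Integrable.of_finite (μ := ν.map fun (ξ : Boundary K) (i : Fin n) => ξ i)
      (f := fun v : Fin n → Fin K => mean ν u (List.ofFn v))).comp_measurable
      (measurable_restrict K n)
  refine ae_eq_condExp_of_forall_setIntegral_eq ((cylFiltration K).le n) hu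
    (fun s _ _ => hi.integrableOn) ?_ ?_
  · rintro s ⟨T, -, rfl⟩ -
    have hT : (fun (ξ : Boundary K) (i : Fin n) => ξ i) ⁻¹' T =
        ⋃ v ∈ T.toFinite.toFinset, cyl (List.ofFn v) := by
      ext ξ; simp [mem_cyl_ofFn]
    rw [hT]
    have hd : Set.Pairwise (T.toFinite.toFinset : Set (Fin n → Fin K))
        (Function.onFun Disjoint fun v : Fin n → Fin K => cyl (List.ofFn v)) :=
      (pairwise_disjoint_cyl_ofFn n).set_pairwise _
    rw [integral_biUnion_finset _ (fun v _ => measurableSet_cyl _) hd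
      fun v _ => hi.integrableOn, integral_biUnion_finset _ (fun v _ => measurableSet_cyl _) hd
      fun v _ => hu.integrableOn]
    refine Finset.sum_congr rfl fun v _ => ?_
    have h : ∀ ξ ∈ cyl (List.ofFn v), mean ν u (pre ξ n) = mean ν u (List.ofFn v) :=
      fun ξ hξ => by rw [pre, mem_cyl_ofFn.1 hξ]
    rw [setIntegral_congr_fun (measurableSet_cyl _) h, setIntegral_const, mean,
      measure_smul_setAverage _ (measure_ne_top _ _)]
  · refine StronglyMeasurable.aestronglyMeasurable (Measurable.stronglyMeasurable ?_)
    exact (measurable_of_countable fun v : Fin n → Fin K => mean ν u (List.ofFn v)).comp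
      (comap_measurable fun (ξ : Boundary K) (j : Fin n) => ξ j)

/-- Lévy's upward theorem for the cylinder filtration. -/
theorem ae_tendsto_mean_pre {ν : Measure (Boundary K)} [IsFiniteMeasure ν]
    {u : Boundary K → ℝ} (hu : Integrable u ν) :
    ∀ᵐ ξ ∂ν, Tendsto (fun n => mean ν u (pre ξ n)) atTop (𝓝 (u ξ)) := by
  have h1 := MeasureTheory.tendsto_ae_condExp (μ := ν) (ℱ := cylFiltration K) u
  have h2 : ν[u | ⨆ n, cylFiltration K n] =ᵐ[ν] u := by
    rw [iSup_cylFiltration]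
    exact condExp_of_aestronglyMeasurable' le_rfl hu.aestronglyMeasurable hu
  have h3 := ae_all_iff.2 fun n => mean_pre_ae_eq_condExp hu n
  filter_upwards [h1, h2, h3] with ξ h1 h2 h3
  rw [h2] at h1
  exact h1.congr fun n => (h3 n).symm

/-- The boundary values are controlled by the mean value at the root and the weighted differences
of consecutive means: this is where the condition on `λ` enters. -/
theorem exists_lintegral_enorm_rpow_le {p lam : ℝ} (hp : 1 ≤ p)
    (hlam : (1 < p ∧ p - 1 < lam) ∨ (p = 1 ∧ 0 ≤ lam)) (ε : ℝ)
    (ν : Measure (Boundary K)) [IsFiniteMeasure ν] :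
    ∃ c : ℝ≥0, ∀ u : Boundary K → ℝ, Integrable u ν →
      ∫⁻ ξ, ‖u ξ‖ₑ ^ p ∂ν ≤ c * (‖mean ν u []‖ₑ ^ p + besovEnergy ε 0 lam p ν u) := by
  obtain ⟨c, hc⟩ := exists_tsum_rpow_le_weighted hlam
  have hp0 : 0 < p := by linarith
  refine ⟨2 ^ (p - 1) * max (ν univ).toNNReal c, fun u hu => ?_⟩
  have hpt : ∀ᵐ ξ ∂ν, ‖u ξ‖ₑ ^ p ≤ 2 ^ (p - 1) * (‖mean ν u []‖ₑ ^ p +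
      c * ∑' m : ℕ, ENNReal.ofReal (((m + 1 : ℕ) : ℝ) ^ lam) *
        ‖mean ν u (pre ξ (m + 1)) - mean ν u (pre ξ m)‖ₑ ^ p) := by
    filter_upwards [ae_tendsto_mean_pre hu] with ξ hξ
    have hb : ∀ n, ‖mean ν u (pre ξ n)‖ₑ ≤ ‖mean ν u []‖ₑ +
        ∑ m ∈ Finset.range n, ‖mean ν u (pre ξ (m + 1)) - mean ν u (pre ξ m)‖ₑ := by
      intro n
      induction n with
      | zero => simp [pre]
      | succ n ih =>
        rw [Finset.sum_range_succ, ← add_assoc]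
        calc ‖mean ν u (pre ξ (n + 1))‖ₑ
            = ‖mean ν u (pre ξ n) + (mean ν u (pre ξ (n + 1)) - mean ν u (pre ξ n))‖ₑ := by
              congr 1; ring
          _ ≤ _ := (enorm_add_le _ _).trans (by gcongr)
    have hb' : ‖u ξ‖ₑ ≤ ‖mean ν u []‖ₑ +
        ∑' m : ℕ, ‖mean ν u (pre ξ (m + 1)) - mean ν u (pre ξ m)‖ₑ :=
      le_of_tendsto hξ.enorm (Eventually.of_forall fun n =>
        (hb n).trans (by gcongr; exact ENNReal.sum_le_tsum _))
    refine (ENNReal.rpow_le_rpow hb' hp0.le).trans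
      ((ENNReal.rpow_add_le_mul_rpow_add_rpow _ _ hp).trans ?_)
    gcongr
    exact hc _
  have hm : ∀ m : ℕ, Measurable fun ξ : Boundary K =>
      ENNReal.ofReal (((m + 1 : ℕ) : ℝ) ^ lam) *
        ‖mean ν u (pre ξ (m + 1)) - mean ν u (pre ξ m)‖ₑ ^ p := fun m =>
    (((measurable_comp_pre _ _).sub (measurable_comp_pre _ _)).enorm.pow_const p).const_mul _
  refine (lintegral_mono_ae hpt).trans ?_
  rw [lintegral_const_mul' _ _ (by simp), lintegral_add_left measurable_const,
    lintegral_const_mul' _ _ (by simp), lintegral_tsum fun m => (hm m).aemeasurable,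
    lintegral_const, besovEnergy_zero_eq]
  simp only [lintegral_const_mul' _ _ ENNReal.ofReal_ne_top]
  push_cast
  rw [mul_assoc, ENNReal.coe_rpow_of_nonneg _ (by linarith), mul_add (max _ _),
    ENNReal.coe_toNNReal (measure_ne_top _ _), mul_comm (‖mean ν u []‖ₑ ^ p)]
  gcongr
  · exact le_rfl
  · exact le_max_left _ _
  · exact le_max_right _ _

/-! ### Ahlfors regularity and the measure of cylinders -/

/-- A cylinder of level `n ≥ 1` is the ball of radius `(2/ε) e^{-ε(n-1)}` around each of its points.
(At level `0` this radius would exceed the diameter.) -/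
theorem setOf_boundaryDist_lt_eq_cyl (hε : 0 < ε) {v : List (Fin K)} (hv : v ≠ []) {ξ : Boundary K}
    (hξ : ξ ∈ cyl v) :
    {ζ | boundaryDist ε ξ ζ < 2 / ε * Real.exp (-ε * ((v.length : ℝ) - 1))} = cyl v := by
  have hn : 0 < v.length := List.length_pos_iff.2 hv
  ext ζ
  rcases eq_or_ne ξ ζ with rfl | hne
  · simp only [boundaryDist, if_true, mem_ofPred_eq, hξ, iff_true]
    positivity
  have h1 : boundaryDist ε ξ ζ < 2 / ε * Real.exp (-ε * ((v.length : ℝ) - 1)) ↔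
      v.length ≤ PiNat.firstDiff ξ ζ := by
    rw [boundaryDist, if_neg hne, mul_lt_mul_iff_right₀ (by positivity), Real.exp_lt_exp,
      neg_mul, neg_mul, neg_lt_neg_iff, mul_lt_mul_iff_right₀ hε, sub_lt_iff_lt_add]
    norm_cast
    omega
  rw [mem_ofPred_eq, h1, ← PiNat.mem_cylinder_iff_le_firstDiff hne]
  exact forall₂_congr fun i hi => by rw [hξ i hi, eq_comm]

theorem exists_measure_cyl_bounds (hK : 2 ≤ K) (hε : 0 < ε) {ν : Measure (Boundary K)}
    (hν : AhlforsRegular ε (Real.log K / ε) ν) :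
    ∃ a b : ℝ, 0 < a ∧ 0 < b ∧ ∀ v : List (Fin K), v ≠ [] →
      ENNReal.ofReal (a * Real.exp (-Real.log K * v.length)) ≤ ν (cyl v) ∧
        ν (cyl v) ≤ ENNReal.ofReal (b * Real.exp (-Real.log K * v.length)) := by
  obtain ⟨A, hA, h⟩ := hν
  set Q := Real.log K / ε with hQ
  have hεQ : ε * Q = Real.log K := by rw [hQ]; field_simp
  refine ⟨(2 / ε) ^ Q * Real.exp (Real.log K) / A, A * ((2 / ε) ^ Q * Real.exp (Real.log K)),
    by positivity, by positivity, fun v hv => ?_⟩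
  have hn : (1 : ℝ) ≤ v.length := by exact_mod_cast List.length_pos_iff.2 hv
  have hr : (2 / ε * Real.exp (-ε * ((v.length : ℝ) - 1))) ^ Q =
      (2 / ε) ^ Q * Real.exp (Real.log K) * Real.exp (-Real.log K * v.length) := by
    rw [Real.mul_rpow (by positivity) (by positivity), ← Real.exp_mul, mul_assoc,
      mul_assoc ((2 / ε) ^ Q), ← Real.exp_add]
    congr 2
    linear_combination (1 - (v.length : ℝ)) * hεQ
  obtain ⟨ξ, hξ⟩ : ∃ ξ : Boundary K, ξ ∈ cyl v :=
    ⟨fun i => if hi : i < v.length then v[i] else ⟨0, by omega⟩, fun i hi => by simp [hi]⟩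
  have := h ξ (2 / ε * Real.exp (-ε * ((v.length : ℝ) - 1))) (by positivity)
    (mul_le_of_le_one_right (by positivity) (Real.exp_le_one_iff.2 (by nlinarith)))
  rw [setOf_boundaryDist_lt_eq_cyl hε hv hξ, hr] at this
  rw [div_mul_eq_mul_div, mul_assoc A]
  exact this

theorem isFiniteMeasure_of_ahlforsRegular (hK : 2 ≤ K) (hε : 0 < ε) {ν : Measure (Boundary K)}
    (hν : AhlforsRegular ε (Real.log K / ε) ν) : IsFiniteMeasure ν := by
  obtain ⟨a, b, -, -, h⟩ := exists_measure_cyl_bounds hK hε hν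
  refine ⟨?_⟩
  rw [← iUnion_cyl_ofFn K 1]
  refine (measure_iUnion_le _).trans_lt ?_
  rw [tsum_fintype]
  exact ENNReal.sum_lt_top.2 fun v _ => (h _ (by simp)).2.trans_lt ENNReal.ofReal_lt_top

/-! ### Points of the tree as pairs of a word and a height -/

theorem dist_eq_len (x y : Tree K ε) :
    dist x y = len ε x.height + len ε y.height - 2 * len ε (meet x y) := treeDist_eq x y

theorem len_zero (ε : ℝ) : len ε 0 = 0 := by simp [len]

theorem height_le_length_word (x : Tree K ε) : x.height ≤ x.word.length := by
  rw [x.length_word]; exact Nat.le_ceil _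

theorem length_dropLast_le_height (x : Tree K ε) : (x.word.dropLast.length : ℝ) ≤ x.height := by
  rw [List.length_dropLast, x.length_word]
  rcases Nat.eq_zero_or_pos ⌈x.height⌉₊ with h | h
  · simpa [h] using x.height_nonneg
  · exact (Nat.lt_ceil.1 (by omega)).le

theorem dist_vertex_nil (x : Tree K ε) : dist (vertex ε []) x = len ε x.height := by
  have h : meet (vertex ε []) x = 0 := by
    simp [meet, vertex, commonLen, x.height_nonneg]
  rw [dist_eq_len, h]
  simp [vertex, len_zero]

theorem continuous_len_height : Continuous fun x : Tree K ε => len ε x.height := by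
  simp only [← dist_vertex_nil]
  fun_prop

theorem measurable_height : Measurable fun x : Tree K ε => x.height := by
  refine measurable_of_Iic fun a => ?_
  have : (fun x : Tree K ε => x.height) ⁻¹' Iic a = (fun x => len ε x.height) ⁻¹' Iic (len ε a) := by
    ext x; simp [(len_strictMono ε).le_iff_le]
  rw [this]
  exact continuous_len_height.measurable measurableSet_Iic

/-- The half-open edge that ends at `v` in terms of the metric, so that it is seen to be Borel. -/
theorem word_eq_iff (x : Tree K ε) (v : List (Fin K)) :
    x.word = v ↔ (v.length : ℝ) - 1 < x.height ∧
      dist x (vertex ε v) = len ε v.length - len ε x.height := by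
  have hd : dist x (vertex ε v) = len ε v.length - len ε x.height ↔
      meet x (vertex ε v) = x.height := by
    rw [dist_eq_len, ← (len_strictMono ε).injective.eq_iff (a := meet x (vertex ε v))]
    change len ε x.height + len ε v.length - _ = _ ↔ _
    constructor <;> intro h <;> linarith
  rw [hd]
  constructor
  · rintro rfl
    refine ⟨?_, ?_⟩
    · rw [x.length_word]
      linarith [Nat.ceil_lt_add_one x.height_nonneg]
    · have h := height_le_length_word x
      simp [meet, vertex, commonLen_self, h]
  · rintro ⟨h1, h2⟩
    have h3 : x.height ≤ commonLen x.word v := h2 ▸ min_le_right _ _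
    have h4 : x.word.length ≤ commonLen x.word v := by
      rw [x.length_word]; exact Nat.ceil_le.2 h3
    obtain ⟨-, h5, h6⟩ := (le_commonLen _ _ _).1 h4
    have h7 : v.length ≤ x.word.length := by
      rw [x.length_word]
      have : (v.length : ℝ) < ⌈x.height⌉₊ + 1 := by linarith [Nat.le_ceil x.height]
      exact Nat.lt_succ_iff.1 (by exact_mod_cast this)
    rwa [List.take_length, List.take_of_length_le h7] at h6

theorem measurableSet_word_eq (v : List (Fin K)) : MeasurableSet {x : Tree K ε | x.word = v} := by
  simp only [word_eq_iff]
  refine (measurableSet_lt measurable_const measurable_height).inter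
    (measurableSet_eq_fun (by fun_prop) ?_)
  exact measurable_const.sub continuous_len_height.measurable

/-- A function of the word and the height is Borel as soon as it is Borel on each edge. -/
theorem measurable_of_word_height {α : Type*} [MeasurableSpace α] {G : List (Fin K) → ℝ → α}
    (hG : ∀ w, Measurable (G w)) : Measurable fun x : Tree K ε => G x.word x.height := by
  let : MeasurableSpace (List (Fin K)) := ⊤
  have : MeasurableSingletonClass (List (Fin K)) := ⟨fun _ => trivial⟩
  have hw : Measurable fun x : Tree K ε => x.word :=
    measurable_to_countable' fun v => measurableSet_word_eq v
  exact (measurable_from_prod_countable_right (f := fun q : List (Fin K) × ℝ => G q.1 q.2)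
    hG).comp (hw.prodMk measurable_height)

theorem height_anc (x : Tree K ε) {t : ℝ} (h0 : 0 ≤ t) (ht : t ≤ x.height) :
    (anc x t).height = t := by simp [anc, h0, ht]

theorem word_anc (x : Tree K ε) {t : ℝ} (h0 : 0 ≤ t) (ht : t ≤ x.height) :
    (anc x t).word = x.word.take ⌈t⌉₊ := by simp [anc, h0, ht]

theorem ceil_eq_succ {m : ℕ} {t : ℝ} (ht : t ∈ Ioc (m : ℝ) (m + 1)) : ⌈t⌉₊ = m + 1 := by
  rw [Nat.ceil_eq_iff (by omega)]
  exact_mod_cast ht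

theorem word_anc_of_mem_Ioc {m : ℕ} {v : List (Fin K)} (hv : v.length = m + 1) {t : ℝ}
    (ht : t ∈ Ioc (m : ℝ) (m + 1)) : (anc (vertex ε v) t).word = v := by
  have h0 : 0 ≤ t := (Nat.cast_nonneg m).trans ht.1.le
  rw [word_anc _ h0 (by simpa [vertex, hv] using ht.2), ceil_eq_succ ht, ← hv]
  exact List.take_length

theorem height_anc_of_mem_Ioc {m : ℕ} {v : List (Fin K)} (hv : v.length = m + 1) {t : ℝ}
    (ht : t ∈ Ioc (m : ℝ) (m + 1)) : (anc (vertex ε v) t).height = t :=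
  height_anc _ ((Nat.cast_nonneg m).trans ht.1.le) (by simpa [vertex, hv] using ht.2)

theorem anc_height (x : Tree K ε) : anc x x.height = x := by
  refine Tree.ext (height_anc x x.height_nonneg le_rfl) ?_
  rw [word_anc x x.height_nonneg le_rfl, ← x.length_word, List.take_length]

theorem meet_nonneg (x y : Tree K ε) : 0 ≤ meet x y :=
  le_min (le_min x.height_nonneg y.height_nonneg) (Nat.cast_nonneg _)

theorem anc_meet_eq (x y : Tree K ε) : anc x (meet x y) = anc y (meet x y) := by
  refine Tree.ext ?_ ?_
  · rw [height_anc _ (meet_nonneg x y) (meet_le_left x y),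
      height_anc _ (meet_nonneg x y) (meet_le_right x y)]
  · rw [word_anc _ (meet_nonneg x y) (meet_le_left x y),
      word_anc _ (meet_nonneg x y) (meet_le_right x y)]
    have h : ⌈meet x y⌉₊ ≤ commonLen x.word y.word := Nat.ceil_le.2 (min_le_right _ _)
    exact ((le_commonLen _ _ _).1 h).2.2

/-! ### Integration with respect to the weighted measure -/

theorem tsum_word_ne_nil (f : List (Fin K) → ℝ≥0∞) :
    ∑' v : {v : List (Fin K) // v ≠ []}, f v = ∑' m : ℕ, ∑ v : Fin (m + 1) → Fin K,
      f (List.ofFn v) := by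
  have h1 : ∑' v : {v : List (Fin K) // v ≠ []}, f v =
      ∑' v, ({v : List (Fin K) | v ≠ []}.indicator f) v := tsum_subtype _ f
  rw [h1, ← List.equivSigmaTuple.symm.tsum_eq, ENNReal.tsum_sigma',
    tsum_eq_zero_add' ENNReal.summable]
  simp [List.equivSigmaTuple, tsum_fintype]

/-- `∫ F dμ_λ` is a sum over the edges; the edges of level `m + 1` are indexed by the words of length
`m + 1` of their lower end points. -/
theorem lintegral_mu (β C lam : ℝ) {F : Tree K ε → ℝ≥0∞} (hF : Measurable F) :
    ∫⁻ x, F x ∂mu K ε β C lam = ∑' m : ℕ, ∑ v : Fin (m + 1) → Fin K,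
      ∫⁻ t in Ioc (m : ℝ) (m + 1), ENNReal.ofReal (Real.exp (-β * t) * (t + C) ^ lam) *
        F (anc (vertex ε (List.ofFn v)) t) := by
  have hw : Measurable fun x : Tree K ε =>
      ENNReal.ofReal (Real.exp (-β * x.height) * (x.height + C) ^ lam) :=
    measurable_of_word_height (G := fun _ h => ENNReal.ofReal (Real.exp (-β * h) * (h + C) ^ lam))
      fun _ => by fun_prop
  rw [mu, lintegral_withDensity_eq_lintegral_mul _ hw hF, edgeMeasure, lintegral_sum_measure]
  have hmap := fun v : List (Fin K) => lintegral_map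
    (μ := volume.restrict (Ioc ((v.length : ℝ) - 1) v.length)) (hw.mul hF)
    (continuous_anc (vertex ε v)).measurable
  rw [tsum_congr fun v : {v : List (Fin K) // v ≠ []} => hmap v.1]
  simp only [Pi.mul_apply]
  rw [tsum_word_ne_nil fun w => ∫⁻ t in Ioc ((w.length : ℝ) - 1) w.length,
    ENNReal.ofReal (Real.exp (-β * (anc (vertex ε w) t).height) *
      ((anc (vertex ε w) t).height + C) ^ lam) * F (anc (vertex ε w) t)]
  refine tsum_congr fun m => Finset.sum_congr rfl fun v _ => ?_
  have hl : (List.ofFn v).length = m + 1 := by simp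
  rw [hl, Nat.cast_add, Nat.cast_one, add_sub_cancel_right]
  refine setLIntegral_congr_fun measurableSet_Ioc fun t ht => ?_
  simp only [height_anc_of_mem_Ioc hl ht]

/-- On the edges of level `m + 1`, the density of `μ_λ` is comparable to `e^{-β(m+1)} (m+1)^λ`. -/
theorem exists_density_bounds {β C lam : ℝ} (hβ : 0 ≤ β) (hC : 0 < C) (hlam : 0 ≤ lam) :
    ∃ a b : ℝ, 0 < a ∧ 0 < b ∧ ∀ (m : ℕ), ∀ t ∈ Ioc (m : ℝ) (m + 1),
      a * (Real.exp (-β * ((m + 1 : ℕ) : ℝ)) * ((m + 1 : ℕ) : ℝ) ^ lam) ≤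
          Real.exp (-β * t) * (t + C) ^ lam ∧
        Real.exp (-β * t) * (t + C) ^ lam ≤
          b * (Real.exp (-β * ((m + 1 : ℕ) : ℝ)) * ((m + 1 : ℕ) : ℝ) ^ lam) := by
  have hmin : 0 < min C 1 := lt_min hC one_pos
  refine ⟨min C 1 ^ lam, Real.exp β * (1 + C) ^ lam, by positivity, by positivity,
    fun m t ht => ?_⟩
  have hm : (0 : ℝ) ≤ m := Nat.cast_nonneg m
  push_cast
  constructor
  · have h1 : Real.exp (-β * (m + 1)) ≤ Real.exp (-β * t) :=
      Real.exp_le_exp.2 (by nlinarith [ht.2])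
    have h2 : min C 1 ^ lam * ((m : ℝ) + 1) ^ lam ≤ (t + C) ^ lam := by
      rw [← Real.mul_rpow hmin.le (by positivity)]
      refine Real.rpow_le_rpow (by positivity) ?_ hlam
      nlinarith [ht.1, min_le_left C 1, min_le_right C 1]
    calc _ = Real.exp (-β * (m + 1)) * (min C 1 ^ lam * ((m : ℝ) + 1) ^ lam) := by ring
      _ ≤ _ := by gcongr
  · have h1 : Real.exp (-β * t) ≤ Real.exp β * Real.exp (-β * (m + 1)) := by
      rw [← Real.exp_add]
      exact Real.exp_le_exp.2 (by nlinarith [ht.1])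
    have h2 : (t + C) ^ lam ≤ (1 + C) ^ lam * ((m : ℝ) + 1) ^ lam := by
      rw [← Real.mul_rpow (by positivity) (by positivity)]
      exact Real.rpow_le_rpow (by linarith [ht.1]) (by nlinarith [ht.2]) hlam
    calc _ ≤ (Real.exp β * Real.exp (-β * (m + 1))) * ((1 + C) ^ lam * ((m : ℝ) + 1) ^ lam) := by
          gcongr
          exact Real.rpow_nonneg (by linarith [ht.1]) _
      _ = _ := by ring

/-- The integral of a function of the word, compared with integrals over the boundary. -/
theorem exists_lintegral_comp_word_le (hK : 2 ≤ K) (hε : 0 < ε) {β C lam : ℝ}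
    (hβ : 0 ≤ β) (hC : 0 < C) (hlam : 0 ≤ lam) {ν : Measure (Boundary K)}
    (hν : AhlforsRegular ε (Real.log K / ε) ν) :
    ∃ c : ℝ≥0, ∀ F : List (Fin K) → ℝ≥0∞, ∫⁻ x, F x.word ∂mu K ε β C lam ≤
      c * ∑' m : ℕ, ENNReal.ofReal (Real.exp (-(β - Real.log K) * ((m + 1 : ℕ) : ℝ)) *
        ((m + 1 : ℕ) : ℝ) ^ lam) * ∫⁻ ξ, F (pre ξ (m + 1)) ∂ν := by
  obtain ⟨a, b, ha, hb, hab⟩ := exists_measure_cyl_bounds hK hε hν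
  obtain ⟨a', b', ha', hb', hab'⟩ := exists_density_bounds hβ hC hlam
  refine ⟨(b' / a).toNNReal, fun F => ?_⟩
  rw [lintegral_mu _ _ _ (measurable_of_word_height fun _ => measurable_const),
    ← ENNReal.tsum_mul_left]
  refine ENNReal.tsum_le_tsum fun m => ?_
  rw [lintegral_comp_pre ν (m + 1), Finset.mul_sum, Finset.mul_sum]
  refine Finset.sum_le_sum fun v _ => ?_
  have hl : (List.ofFn v).length = m + 1 := by simp
  set n : ℝ := ((m + 1 : ℕ) : ℝ) with hn
  have h1 : ∀ t ∈ Ioc (m : ℝ) (m + 1), ENNReal.ofReal (Real.exp (-β * t) * (t + C) ^ lam) *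
      F (anc (vertex ε (List.ofFn v)) t).word ≤
        ENNReal.ofReal (b' * (Real.exp (-β * n) * n ^ lam)) * F (List.ofFn v) := fun t ht => by
    rw [word_anc_of_mem_Ioc hl ht]
    exact mul_le_mul_left (ENNReal.ofReal_le_ofReal (hab' m t ht).2) _
  refine (setLIntegral_mono measurable_const h1).trans ?_
  have h2 := (hab (List.ofFn v) (by simp)).1
  rw [hl] at h2
  rw [setLIntegral_const, Real.volume_Ioc, add_sub_cancel_left, ENNReal.ofReal_one, mul_one]
  calc ENNReal.ofReal (b' * (Real.exp (-β * n) * n ^ lam)) * F (List.ofFn v)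
      = ENNReal.ofReal (b' / a) * (ENNReal.ofReal (Real.exp (-(β - Real.log K) * n) * n ^ lam) *
          (ENNReal.ofReal (a * Real.exp (-Real.log K * n)) * F (List.ofFn v))) := by
        rw [← mul_assoc (ENNReal.ofReal (b' / a)),
          ← mul_assoc (ENNReal.ofReal (b' / a) * _),
          ← ENNReal.ofReal_mul (by positivity), ← ENNReal.ofReal_mul (by positivity)]
        congr 2
        rw [show -β * n = -(β - Real.log K) * n + -Real.log K * n by ring, Real.exp_add]
        field_simp
    _ ≤ _ := by
        rw [ENNReal.ofReal]
        gcongr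

theorem exists_sum_edges_le_lintegral_mu {β C lam : ℝ}
    (hβ : 0 ≤ β) (hC : 0 < C) (hlam : 0 ≤ lam) :
    ∃ c : ℝ≥0, ∀ G : Tree K ε → ℝ≥0∞, Measurable G →
      ∑' m : ℕ, ∑ v : Fin (m + 1) → Fin K,
        ENNReal.ofReal (Real.exp (-β * ((m + 1 : ℕ) : ℝ)) * ((m + 1 : ℕ) : ℝ) ^ lam) *
          ∫⁻ t in Ioc (m : ℝ) (m + 1), G (anc (vertex ε (List.ofFn v)) t) ≤
        c * ∫⁻ x, G x ∂mu K ε β C lam := by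
  obtain ⟨a, b, ha, hb, hab⟩ := exists_density_bounds hβ hC hlam
  refine ⟨(1 / a).toNNReal, fun G hG => ?_⟩
  rw [lintegral_mu _ _ _ hG, ← ENNReal.tsum_mul_left]
  refine ENNReal.tsum_le_tsum fun m => ?_
  rw [Finset.mul_sum]
  refine Finset.sum_le_sum fun v _ => ?_
  rw [← lintegral_const_mul' _ _ ENNReal.ofReal_ne_top,
    ← lintegral_const_mul' _ _ ENNReal.coe_ne_top]
  refine lintegral_mono_ae ((ae_restrict_iff' measurableSet_Ioc).2 (ae_of_all _ fun t ht => ?_))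
  rw [← mul_assoc, ← ENNReal.ofReal, ← ENNReal.ofReal_mul (by positivity)]
  refine mul_le_mul_left (ENNReal.ofReal_le_ofReal ?_) _
  have := (hab m t ht).1
  rw [one_div_mul_eq_div, le_div_iff₀ ha]
  linarith

theorem tsum_exp_mul_rpow_ne_top {δ : ℝ} (hδ : 0 < δ) (lam : ℝ) :
    ∑' m : ℕ, ENNReal.ofReal (Real.exp (-δ * ((m + 1 : ℕ) : ℝ)) * ((m + 1 : ℕ) : ℝ) ^ lam) ≠ ∞ := by
  obtain ⟨k, hk⟩ := exists_nat_ge lam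
  have hs : Summable fun n : ℕ => (n : ℝ) ^ k * Real.exp (-δ) ^ n :=
    summable_pow_mul_geometric_of_norm_lt_one k
      (by rw [Real.norm_eq_abs, abs_of_pos (Real.exp_pos _)]; simpa using hδ)
  refine ne_top_of_le_ne_top ((summable_nat_add_iff 1).2 hs).tsum_ofReal_ne_top
    (ENNReal.tsum_le_tsum fun m => ENNReal.ofReal_le_ofReal ?_)
  rw [mul_comm, ← Real.exp_nat_mul, mul_comm (((m + 1 : ℕ) : ℝ)) (-δ), ← Real.rpow_natCast _ k]
  gcongr
  simp

theorem isFiniteMeasure_mu (hK : 2 ≤ K) (hε : 0 < ε) {β C lam : ℝ}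
    (hβ : Real.log K < β) (hC : 0 < C) (hlam : 0 ≤ lam) {ν : Measure (Boundary K)}
    (hν : AhlforsRegular ε (Real.log K / ε) ν) : IsFiniteMeasure (mu K ε β C lam) := by
  have := isFiniteMeasure_of_ahlforsRegular hK hε hν
  have hβ0 : 0 ≤ β := (Real.log_natCast_nonneg K).trans hβ.le
  obtain ⟨c, hc⟩ := exists_lintegral_comp_word_le hK hε hβ0 hC hlam hν
  refine ⟨?_⟩
  rw [← lintegral_one]
  refine (hc fun _ => 1).trans_lt ?_
  simp only [lintegral_one, ENNReal.tsum_mul_right]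
  exact ENNReal.mul_lt_top ENNReal.coe_lt_top (ENNReal.mul_lt_top
    (tsum_exp_mul_rpow_ne_top (sub_pos.2 hβ) lam).lt_top (measure_lt_top _ _))

/-! ### The extension on an edge -/

theorem dist_vertex_dropLast (x : Tree K ε) :
    dist (vertex ε x.word.dropLast) x = len ε x.height - len ε x.word.dropLast.length := by
  have hc : commonLen x.word.dropLast x.word = x.word.dropLast.length := by
    refine le_antisymm ((le_commonLen _ _ _).1 le_rfl).1 ((le_commonLen _ _ _).2 ⟨le_rfl, ?_, ?_⟩)
    · simp
    · rw [List.take_length, List.length_dropLast, List.dropLast_eq_take]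
  have h : meet (vertex ε x.word.dropLast) x = x.word.dropLast.length := by
    simp only [meet, vertex, hc]
    rw [min_eq_left (length_dropLast_le_height x), min_self]
  rw [dist_eq_len, h]
  simp only [vertex]
  ring

/-- The slope, with respect to `d_X`, of the extension on the edge that ends at the vertex `w`; it is
`0 / 0 = 0` at the root. -/
def slope (ε : ℝ) (ν : Measure (Boundary K)) (u : Boundary K → ℝ) (w : List (Fin K)) : ℝ :=
  (mean ν u w - mean ν u w.dropLast) / (len ε w.length - len ε w.dropLast.length)

theorem whitney_eq (ν : Measure (Boundary K)) (u : Boundary K → ℝ) (x : Tree K ε) :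
    whitney ε ν u x = mean ν u x.word.dropLast +
      slope ε ν u x.word * (len ε x.height - len ε x.word.dropLast.length) := by
  rw [whitney, dist_vertex_dropLast, slope]
  have := dist_vertex_dropLast (vertex ε x.word)
  simp only [vertex] at this ⊢
  rw [this]

theorem measurable_whitney (ν : Measure (Boundary K)) (u : Boundary K → ℝ) :
    Measurable (whitney ε ν u) := by
  have h := measurable_of_word_height (ε := ε)
    (G := fun (w : List (Fin K)) h => mean ν u w.dropLast +
      slope ε ν u w * (len ε h - len ε w.dropLast.length))
    fun w => (((continuous_len ε).measurable.sub_const _).const_mul _).const_add _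
  exact (funext fun x => whitney_eq ν u x : whitney ε ν u = _) ▸ h

theorem slope_mul_len_sub {ν : Measure (Boundary K)} {u : Boundary K → ℝ} (w : List (Fin K)) :
    slope ε ν u w * (len ε w.length - len ε w.dropLast.length) =
      mean ν u w - mean ν u w.dropLast := by
  rcases eq_or_ne w [] with rfl | hw
  · simp
  · refine div_mul_cancel₀ _ (sub_pos.2 (len_strictMono ε ?_)).ne'
    have := List.length_pos_iff.2 hw
    rw [List.length_dropLast]
    exact_mod_cast Nat.sub_lt this one_pos

/-- On an edge the extension stays between its values at the end points. -/
theorem abs_whitney_sub_le (ν : Measure (Boundary K)) (u : Boundary K → ℝ) (x : Tree K ε) :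
    |whitney ε ν u x - mean ν u x.word.dropLast| ≤
      |mean ν u x.word - mean ν u x.word.dropLast| := by
  rw [whitney_eq, add_sub_cancel_left, ← slope_mul_len_sub (ε := ε), abs_mul, abs_mul]
  have hm := (len_strictMono ε).monotone
  have h1 := hm (length_dropLast_le_height x)
  have h2 := hm (height_le_length_word x)
  gcongr

theorem whitney_of_height_eq_length (ν : Measure (Boundary K)) (u : Boundary K → ℝ) {x : Tree K ε}
    (hx : x.height = x.word.length) : whitney ε ν u x = mean ν u x.word := by
  rw [whitney_eq, hx, slope_mul_len_sub, add_sub_cancel]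

theorem whitney_vertex (ν : Measure (Boundary K)) (u : Boundary K → ℝ) (w : List (Fin K)) :
    whitney ε ν u (vertex ε w) = mean ν u w :=
  whitney_of_height_eq_length ν u rfl

/-- A formula on closed edges of the geodesic `[0, x]`. At `t = k` the point `anc x t` belongs to the
preceding edge, but the formulas of both edges agree there. -/
theorem whitney_anc (ν : Measure (Boundary K)) (u : Boundary K → ℝ) (x : Tree K ε) {k : ℕ} {t : ℝ}
    (ht : t ∈ Icc (k : ℝ) (k + 1)) (htx : t ≤ x.height) :
    whitney ε ν u (anc x t) = mean ν u (x.word.take k) +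
      slope ε ν u (x.word.take (k + 1)) * (len ε t - len ε k) := by
  have h0 : 0 ≤ t := (Nat.cast_nonneg k).trans ht.1
  rcases ht.1.eq_or_lt with rfl | hkt
  · have hw := word_anc x h0 htx
    have hh := height_anc x h0 htx
    rw [Nat.ceil_natCast] at hw
    rw [whitney_of_height_eq_length, hw, sub_self, mul_zero, add_zero]
    have := (anc x k).length_word
    rw [hh, Nat.ceil_natCast] at this
    rw [this, hh]
  · have hc : ⌈t⌉₊ = k + 1 := ceil_eq_succ ⟨hkt, ht.2⟩
    have hw := word_anc x h0 htx
    rw [hc] at hw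
    have hl : (x.word.take (k + 1)).length = k + 1 := by
      rw [← hw, (anc x t).length_word, height_anc x h0 htx, hc]
    have hd : (x.word.take (k + 1)).dropLast = x.word.take k := by
      rw [List.dropLast_eq_take, hl, List.take_take]
      congr 1
      omega
    have hl' : (x.word.take k).length = k := by
      rw [← hd, List.length_dropLast, hl, Nat.add_sub_cancel]
    rw [whitney_eq, hw, hd, hl', height_anc x h0 htx]

/-! ### An upper gradient of the extension -/

theorem lintegral_Ioc_exp {a b : ℝ} (hab : a ≤ b) :
    ∫⁻ t in Ioc a b, ENNReal.ofReal (Real.exp (-ε * t)) = ENNReal.ofReal (len ε b - len ε a) := by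
  rw [← integral_exp_eq, intervalIntegral.integral_of_le hab,
    ofReal_integral_eq_lintegral_ofReal]
  · exact ((by fun_prop : Continuous fun t => Real.exp (-ε * t)).integrableOn_Icc).mono_set
      Ioc_subset_Icc_self
  · exact ae_of_all _ fun t => (Real.exp_pos _).le

/-- Along a geodesic that starts at the root, the extension changes by at most the integral of its
slope. -/
theorem abs_whitney_anc_sub_le (ν : Measure (Boundary K)) (u : Boundary K → ℝ) (x : Tree K ε)
    {a b : ℝ} (ha : 0 ≤ a) (hab : a ≤ b) (hb : b ≤ x.height) :
    ENNReal.ofReal |whitney ε ν u (anc x b) - whitney ε ν u (anc x a)| ≤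
      ∫⁻ t in Ioc a b, ‖slope ε ν u (anc x t).word‖ₑ * ENNReal.ofReal (Real.exp (-ε * t)) := by
  -- the claim on a single edge
  have key : ∀ (k : ℕ) (a b : ℝ), a ∈ Icc (k : ℝ) (k + 1) → b ∈ Icc (k : ℝ) (k + 1) → a ≤ b →
      b ≤ x.height → ENNReal.ofReal |whitney ε ν u (anc x b) - whitney ε ν u (anc x a)| ≤
        ∫⁻ t in Ioc a b, ‖slope ε ν u (anc x t).word‖ₑ * ENNReal.ofReal (Real.exp (-ε * t)) := by
    intro k a b hak hbk hab hb
    have h1 : ∀ t ∈ Ioc a b, ‖slope ε ν u (anc x t).word‖ₑ * ENNReal.ofReal (Real.exp (-ε * t)) =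
        ‖slope ε ν u (x.word.take (k + 1))‖ₑ * ENNReal.ofReal (Real.exp (-ε * t)) := fun t ht => by
      rw [word_anc x ((Nat.cast_nonneg k).trans (hak.1.trans ht.1.le)) (ht.2.trans hb),
        ceil_eq_succ ⟨hak.1.trans_lt ht.1, ht.2.trans hbk.2⟩]
    rw [setLIntegral_congr_fun measurableSet_Ioc h1, lintegral_const_mul' _ _ enorm_ne_top,
      lintegral_Ioc_exp hab, whitney_anc ν u x hbk hb, whitney_anc ν u x hak (hab.trans hb),
      add_sub_add_left_eq_sub, ← mul_sub, sub_sub_sub_cancel_right, abs_mul,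
      ENNReal.ofReal_mul (abs_nonneg _),
      abs_of_nonneg (sub_nonneg.2 ((len_strictMono ε).monotone hab)), Real.enorm_eq_ofReal_abs]
  -- gluing of adjacent edges
  have main : ∀ (n : ℕ) (b : ℝ), b ≤ n → a ≤ b → b ≤ x.height →
      ENNReal.ofReal |whitney ε ν u (anc x b) - whitney ε ν u (anc x a)| ≤
        ∫⁻ t in Ioc a b, ‖slope ε ν u (anc x t).word‖ₑ * ENNReal.ofReal (Real.exp (-ε * t)) := by
    intro n
    induction n with
    | zero =>
      intro b hb hab _
      have : b = a := by simp at hb; linarith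
      simp [this]
    | succ n ih =>
      intro b hbn hab hb
      push_cast at hbn
      rcases le_total b n with h | h
      · exact ih b h hab hb
      rcases le_total (n : ℝ) a with h' | h'
      · exact key n a b ⟨h', hab.trans hbn⟩ ⟨h, hbn⟩ hab hb
      · rw [← Ioc_union_Ioc_eq_Ioc h' h, lintegral_union measurableSet_Ioc
          (Ioc_disjoint_Ioc_of_le le_rfl)]
        refine le_trans ?_ (add_le_add (ih n le_rfl h' (h.trans hb))
          (key n n b ⟨le_rfl, by linarith⟩ ⟨h, hbn⟩ h hb))
        rw [← ENNReal.ofReal_add (abs_nonneg _) (abs_nonneg _), add_comm |_|]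
        exact ENNReal.ofReal_le_ofReal (abs_sub_le _ _ _)
  exact main ⌈b⌉₊ b (Nat.le_ceil b) hab hb

theorem isUpperGradient_slope (ν : Measure (Boundary K)) (u : Boundary K → ℝ) :
    IsUpperGradient (whitney ε ν u) fun x : Tree K ε => ‖slope ε ν u x.word‖ₑ := by
  refine ⟨measurable_of_word_height (G := fun w _ => ‖slope ε ν u w‖ₑ) fun _ => measurable_const,
    fun x y => ?_⟩
  have hx := abs_whitney_anc_sub_le ν u x (meet_nonneg x y) (meet_le_left x y) le_rfl
  have hy := abs_whitney_anc_sub_le ν u y (meet_nonneg x y) (meet_le_right x y) le_rfl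
  rw [anc_height] at hx hy
  rw [← anc_meet_eq] at hy
  refine le_trans ?_ (add_le_add hx hy)
  rw [← ENNReal.ofReal_add (abs_nonneg _) (abs_nonneg _), abs_sub_comm (whitney ε ν u y)]
  exact ENNReal.ofReal_le_ofReal (abs_sub_le _ _ _)

/-! ### Comparison of the energies -/

theorem exp_le_len_sub (hε : 0 < ε) (m : ℕ) :
    Real.exp (-ε * ((m + 1 : ℕ) : ℝ)) ≤ len ε ((m + 1 : ℕ) : ℝ) - len ε m := by
  have hc : Continuous fun s => Real.exp (-ε * s) := by fun_prop
  have h := intervalIntegral.integral_mono_on (a := m) (b := ((m + 1 : ℕ) : ℝ)) (μ := volume)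
    (f := fun _ => Real.exp (-ε * ((m + 1 : ℕ) : ℝ))) (g := fun s => Real.exp (-ε * s))
    (by simp) (by simp) (hc.intervalIntegrable _ _)
    fun s hs => Real.exp_le_exp.2 (by nlinarith [hs.2])
  rw [integral_exp_eq, intervalIntegral.integral_const] at h
  simpa using h

theorem exists_gradEnergy_whitney_le (hK : 2 ≤ K) (hε : 0 < ε) {β C lam p : ℝ}
    (hβ : 0 ≤ β) (hC : 0 < C) (hlam : 0 ≤ lam) (hp : 0 < p) (hpε : ε * p = β - Real.log K)
    {ν : Measure (Boundary K)} (hν : AhlforsRegular ε (Real.log K / ε) ν) :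
    ∃ c : ℝ≥0, ∀ u : Boundary K → ℝ,
      gradEnergy (mu K ε β C lam) p (whitney ε ν u) ≤ c * besovEnergy ε 0 lam p ν u := by
  obtain ⟨c, hc⟩ := exists_lintegral_comp_word_le hK hε hβ hC hlam hν
  refine ⟨c, fun u => (iInf₂_le _ (isUpperGradient_slope ν u)).trans ?_⟩
  refine (hc fun w => ‖slope ε ν u w‖ₑ ^ p).trans ?_
  rw [besovEnergy_zero_eq]
  refine mul_le_mul_right (ENNReal.tsum_le_tsum fun m => ?_) _
  set n : ℝ := ((m + 1 : ℕ) : ℝ) with hn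
  have h1 : ∀ ξ : Boundary K, ‖slope ε ν u (pre ξ (m + 1))‖ₑ ^ p ≤
      ENNReal.ofReal (Real.exp ((β - Real.log K) * n)) *
        ‖mean ν u (pre ξ (m + 1)) - mean ν u (pre ξ m)‖ₑ ^ p := fun ξ => by
    have hl := exp_le_len_sub hε m
    have h2 : ‖slope ε ν u (pre ξ (m + 1))‖ₑ ≤ ENNReal.ofReal (Real.exp (ε * n)) *
        ‖mean ν u (pre ξ (m + 1)) - mean ν u (pre ξ m)‖ₑ := by
      rw [slope, dropLast_pre, length_pre, length_pre, ← hn, Real.enorm_eq_ofReal_abs,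
        Real.enorm_eq_ofReal_abs, ← ENNReal.ofReal_mul (Real.exp_pos _).le, abs_div,
        abs_of_pos ((Real.exp_pos _).trans_le hl), div_eq_inv_mul]
      refine ENNReal.ofReal_le_ofReal (mul_le_mul_of_nonneg_right ?_ (abs_nonneg _))
      refine inv_le_of_inv_le₀ (Real.exp_pos _) ?_
      rwa [← Real.exp_neg, ← neg_mul]
    refine (ENNReal.rpow_le_rpow h2 hp.le).trans (le_of_eq ?_)
    rw [ENNReal.mul_rpow_of_nonneg _ _ hp.le, ENNReal.ofReal_rpow_of_pos (Real.exp_pos _),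
      ← Real.exp_mul, ← hpε, mul_right_comm]
  refine (mul_le_mul_right (lintegral_mono h1) _).trans (le_of_eq ?_)
  rw [lintegral_const_mul' _ _ ENNReal.ofReal_ne_top, ← mul_assoc,
    ← ENNReal.ofReal_mul (by positivity), mul_right_comm, ← Real.exp_add]
  congr 2
  rw [show -(β - Real.log K) * n + (β - Real.log K) * n = 0 by ring, Real.exp_zero, one_mul]

/-- Each upper gradient `g` of the extension has integral `∫ g ds_X ≥ |u_I - u_Î|` over the edge that
ends at the vertex of `I`; the factor `e^{-εm}` bounds the density of `ds_X` on this edge. -/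
theorem enorm_mean_sub_le_lintegral (hε : 0 < ε) {ν : Measure (Boundary K)} {u : Boundary K → ℝ}
    {g : Tree K ε → ℝ≥0∞} (hg : IsUpperGradient (whitney ε ν u) g) {m : ℕ} {v : List (Fin K)}
    (hv : v.length = m + 1) :
    ‖mean ν u v - mean ν u v.dropLast‖ₑ ≤ ENNReal.ofReal (Real.exp (-ε * m)) *
      ∫⁻ t in Ioc (m : ℝ) (m + 1), g (anc (vertex ε v) t) := by
  have hl : v.dropLast.length = m := by simp [hv]
  have hmeet : meet (vertex ε v) (vertex ε v.dropLast) = m := by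
    have hc : commonLen v v.dropLast = m := by
      refine le_antisymm (hl ▸ ((le_commonLen _ _ _).1 le_rfl).2.1)
        ((le_commonLen _ _ _).2 ⟨by omega, by omega, ?_⟩)
      rw [List.dropLast_eq_take, List.take_take]
      congr 1
      omega
    simp [meet, vertex, hc, hl, hv]
  have h := hg.2 (vertex ε v) (vertex ε v.dropLast)
  rw [whitney_vertex, whitney_vertex, geodesicIntegral, hmeet] at h
  have e1 : (vertex ε v).height = m + 1 := by simp [vertex, hv]
  have e2 : (vertex ε v.dropLast).height = m := by simp [vertex, hv]
  rw [e1, e2, Ioc_self, Measure.restrict_empty, lintegral_zero_measure, add_zero] at h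
  rw [Real.enorm_eq_ofReal_abs, ← lintegral_const_mul' _ _ ENNReal.ofReal_ne_top]
  refine h.trans ?_
  refine setLIntegral_mono_ae' measurableSet_Ioc (ae_of_all _ fun t ht => ?_)
  rw [mul_comm]
  exact mul_le_mul_left (ENNReal.ofReal_le_ofReal (Real.exp_le_exp.2 (by nlinarith [ht.1]))) _

/-- On each edge, Jensen's inequality compares an arbitrary upper gradient with a constant one. -/
theorem exists_besovEnergy_le_gradEnergy (hK : 2 ≤ K) (hε : 0 < ε) {β C lam p : ℝ}
    (hβ : 0 ≤ β) (hC : 0 < C) (hlam : 0 ≤ lam) (hp : 1 ≤ p) (hpε : ε * p = β - Real.log K)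
    {ν : Measure (Boundary K)} (hν : AhlforsRegular ε (Real.log K / ε) ν) :
    ∃ c : ℝ≥0, ∀ u : Boundary K → ℝ,
      besovEnergy ε 0 lam p ν u ≤ c * gradEnergy (mu K ε β C lam) p (whitney ε ν u) := by
  obtain ⟨a, b, ha, hb, hab⟩ := exists_measure_cyl_bounds hK hε hν
  obtain ⟨c, hc⟩ := exists_sum_edges_le_lintegral_mu (K := K) (ε := ε) hβ hC hlam
  have hp0 : 0 < p := by linarith
  -- adding `1` makes the constant nonzero, so that multiplication by it commutes with the infimum
  refine ⟨(b * Real.exp (ε * p)).toNNReal * c + 1, fun u => ?_⟩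
  rw [gradEnergy, ENNReal.mul_iInf_of_ne (by simp) ENNReal.coe_ne_top]
  refine le_iInf fun g => ?_
  rw [ENNReal.mul_iInf_of_ne (by simp) ENNReal.coe_ne_top]
  refine le_iInf fun hg => ?_
  refine le_trans ?_ (mul_le_mul_left (ENNReal.coe_le_coe.2 le_self_add) _)
  rw [ENNReal.coe_mul, mul_assoc]
  refine le_trans ?_ (mul_le_mul_right (hc _ (hg.1.pow_const p)) _)
  rw [besovEnergy, ← ENNReal.tsum_mul_left]
  refine ENNReal.tsum_le_tsum fun m => ?_
  rw [Finset.mul_sum, Finset.mul_sum]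
  refine Finset.sum_le_sum fun v _ => ?_
  have hl : (List.ofFn v).length = m + 1 := by simp
  have hcyl := (hab (List.ofFn v) (by simp)).2
  rw [hl] at hcyl
  set n : ℝ := ((m + 1 : ℕ) : ℝ) with hn
  have hJ : (∫⁻ t in Ioc (m : ℝ) (m + 1), g (anc (vertex ε (List.ofFn v)) t)) ^ p ≤
      ∫⁻ t in Ioc (m : ℝ) (m + 1), g (anc (vertex ε (List.ofFn v)) t) ^ p := by
    simpa using lintegral_rpow_le_measure_univ_rpow_mul hp
      (μ := volume.restrict (Ioc (m : ℝ) (m + 1)))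
      (hg.1.comp (continuous_anc (vertex ε (List.ofFn v))).measurable).aemeasurable
  have hD : ‖mean ν u (List.ofFn v) - mean ν u (List.ofFn v).dropLast‖ₑ ^ p ≤
      ENNReal.ofReal (Real.exp (-ε * m * p)) *
        ∫⁻ t in Ioc (m : ℝ) (m + 1), g (anc (vertex ε (List.ofFn v)) t) ^ p := by
    refine (ENNReal.rpow_le_rpow (enorm_mean_sub_le_lintegral hε hg hl) hp0.le).trans ?_
    rw [ENNReal.mul_rpow_of_nonneg _ _ hp0.le, ENNReal.ofReal_rpow_of_pos (Real.exp_pos _),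
      ← Real.exp_mul]
    gcongr
  calc _ ≤ ENNReal.ofReal (n ^ lam) * (ENNReal.ofReal (b * Real.exp (-Real.log K * n)) *
        (ENNReal.ofReal (Real.exp (-ε * m * p)) *
          ∫⁻ t in Ioc (m : ℝ) (m + 1), g (anc (vertex ε (List.ofFn v)) t) ^ p)) := by
        rw [mul_zero, zero_mul, Real.exp_zero, one_mul]
        gcongr
    _ = _ := by
        rw [← ENNReal.ofReal]
        simp only [← mul_assoc]
        rw [← ENNReal.ofReal_mul (by positivity), ← ENNReal.ofReal_mul (by positivity),
          ← ENNReal.ofReal_mul (by positivity)]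
        congr 2
        have : Real.exp (-Real.log K * n) * Real.exp (-ε * m * p) =
            Real.exp (ε * p) * Real.exp (-β * n) := by
          rw [← Real.exp_add, ← Real.exp_add]
          congr 1
          rw [hn]
          push_cast
          linear_combination (-(m : ℝ) - 1) * hpε
        linear_combination n ^ lam * b * this

/-! ### Comparison of the `L^p` parts -/

/-- The condition `β > log K` makes the contributions of the levels summable. -/
theorem exists_lintegral_whitney_rpow_le (hK : 2 ≤ K) (hε : 0 < ε) {β C lam p : ℝ}
    (hβ : Real.log K < β) (hC : 0 < C) (hlam : 0 ≤ lam) (hp : 1 ≤ p)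
    {ν : Measure (Boundary K)} (hν : AhlforsRegular ε (Real.log K / ε) ν) :
    ∃ c : ℝ≥0, ∀ u : Boundary K → ℝ, AEStronglyMeasurable u ν →
      ∫⁻ x, ‖whitney ε ν u x‖ₑ ^ p ∂mu K ε β C lam ≤ c * ∫⁻ ξ, ‖u ξ‖ₑ ^ p ∂ν := by
  have := isFiniteMeasure_of_ahlforsRegular hK hε hν
  have hβ0 : 0 ≤ β := (Real.log_natCast_nonneg K).trans hβ.le
  have hp0 : 0 < p := by linarith
  obtain ⟨c, hc⟩ := exists_lintegral_comp_word_le hK hε hβ0 hC hlam hν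
  have hS := tsum_exp_mul_rpow_ne_top (sub_pos.2 hβ) lam
  set S := ∑' m : ℕ, ENNReal.ofReal (Real.exp (-(β - Real.log K) * ((m + 1 : ℕ) : ℝ)) *
    ((m + 1 : ℕ) : ℝ) ^ lam)
  refine ⟨c * (S.toNNReal * (2 ^ p * (2 ^ (p - 1) * 2))), fun u hu => ?_⟩
  have h1 : ∀ x : Tree K ε, ‖whitney ε ν u x‖ₑ ^ p ≤
      2 ^ p * (2 ^ (p - 1) * (‖mean ν u x.word‖ₑ ^ p + ‖mean ν u x.word.dropLast‖ₑ ^ p)) := by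
    intro x
    have h2 : ‖whitney ε ν u x‖ₑ ≤ 2 * (‖mean ν u x.word‖ₑ + ‖mean ν u x.word.dropLast‖ₑ) := by
      have h3 := abs_whitney_sub_le ν u x
      rw [Real.enorm_eq_ofReal_abs, Real.enorm_eq_ofReal_abs, Real.enorm_eq_ofReal_abs,
        ← ENNReal.ofReal_add (abs_nonneg _) (abs_nonneg _), ← ENNReal.ofReal_ofNat,
        ← ENNReal.ofReal_mul (by norm_num)]
      refine ENNReal.ofReal_le_ofReal ?_
      have h4 := abs_sub (mean ν u x.word) (mean ν u x.word.dropLast)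
      have h5 := abs_sub_abs_le_abs_sub (whitney ε ν u x) (mean ν u x.word.dropLast)
      have h6 := abs_nonneg (mean ν u x.word)
      linarith
    refine (ENNReal.rpow_le_rpow h2 hp0.le).trans ?_
    rw [ENNReal.mul_rpow_of_nonneg _ _ hp0.le]
    gcongr
    exact ENNReal.rpow_add_le_mul_rpow_add_rpow _ _ hp
  refine (lintegral_mono h1).trans ((hc fun w =>
    2 ^ p * (2 ^ (p - 1) * (‖mean ν u w‖ₑ ^ p + ‖mean ν u w.dropLast‖ₑ ^ p))).trans ?_)
  rw [ENNReal.coe_mul, mul_assoc]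
  gcongr
  rw [ENNReal.coe_mul, ENNReal.coe_toNNReal hS, mul_assoc, ← ENNReal.tsum_mul_right]
  gcongr with m
  simp only [dropLast_pre]
  rw [lintegral_const_mul' _ _ (by simp), lintegral_const_mul' _ _ (by simp),
    lintegral_add_left ((measurable_comp_pre _ _).enorm.pow_const p)]
  push_cast
  rw [ENNReal.coe_rpow_of_nonneg _ hp0.le, ENNReal.coe_rpow_of_nonneg _ (by linarith), mul_assoc,
    mul_assoc]
  push_cast
  gcongr
  rw [two_mul]
  exact add_le_add (lintegral_enorm_mean_pre_rpow_le hp hu _)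
    (lintegral_enorm_mean_pre_rpow_le hp hu _)

/-- The mean at the root differs from `Eu` on an edge at the root by at most one difference of means,
which the Besov energy controls. -/
theorem exists_enorm_mean_nil_rpow_le (hK : 2 ≤ K) (hε : 0 < ε) {β C lam p : ℝ}
    (hβ : 0 ≤ β) (hC : 0 < C) (hlam : 0 ≤ lam) (hp : 1 ≤ p)
    {ν : Measure (Boundary K)} (hν : AhlforsRegular ε (Real.log K / ε) ν) :
    ∃ c : ℝ≥0, ∀ u : Boundary K → ℝ, ‖mean ν u []‖ₑ ^ p ≤
      c * (∫⁻ x, ‖whitney ε ν u x‖ₑ ^ p ∂mu K ε β C lam + besovEnergy ε 0 lam p ν u) := by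
  have hp0 : 0 < p := by linarith
  obtain ⟨a, b, ha, hb, hab⟩ := exists_measure_cyl_bounds hK hε hν
  obtain ⟨c, hc⟩ := exists_sum_edges_le_lintegral_mu (K := K) (ε := ε) hβ hC hlam
  -- one of the edges at the root
  let v : Fin (0 + 1) → Fin K := fun _ => ⟨0, by omega⟩
  have hl : (List.ofFn v).length = 0 + 1 := by simp
  have hd : (List.ofFn v).dropLast = [] := by simp
  obtain ⟨c', hc'⟩ : ∃ c' : ℝ≥0, (c' : ℝ≥0∞) * ν (cyl (List.ofFn v)) ≥ 1 := by
    obtain ⟨h1, h2⟩ := hab (List.ofFn v) (by simp)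
    have h0 : ν (cyl (List.ofFn v)) ≠ 0 :=
      ((ENNReal.ofReal_pos.2 (by positivity)).trans_le h1).ne'
    refine ⟨(ν (cyl (List.ofFn v)))⁻¹.toNNReal, ge_of_eq ?_⟩
    rw [ENNReal.coe_toNNReal (ENNReal.inv_ne_top.2 h0),
      ENNReal.inv_mul_cancel h0 (ne_top_of_le_ne_top ENNReal.ofReal_ne_top h2)]
  refine ⟨2 ^ (p - 1) * max ((Real.exp β).toNNReal * c) c', fun u => ?_⟩
  have hpt : ∀ t ∈ Ioc (((0 : ℕ) : ℝ)) ((0 : ℕ) + 1), ‖mean ν u []‖ₑ ^ p ≤ 2 ^ (p - 1) *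
      (‖whitney ε ν u (anc (vertex ε (List.ofFn v)) t)‖ₑ ^ p +
        ‖mean ν u (List.ofFn v) - mean ν u []‖ₑ ^ p) := by
    intro t ht
    have h1 := abs_whitney_sub_le ν u (anc (vertex ε (List.ofFn v)) t)
    rw [word_anc_of_mem_Ioc hl ht, hd] at h1
    have h2 : ‖mean ν u []‖ₑ ≤ ‖whitney ε ν u (anc (vertex ε (List.ofFn v)) t)‖ₑ +
        ‖mean ν u (List.ofFn v) - mean ν u []‖ₑ := by
      rw [Real.enorm_eq_ofReal_abs, Real.enorm_eq_ofReal_abs, Real.enorm_eq_ofReal_abs,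
        ← ENNReal.ofReal_add (abs_nonneg _) (abs_nonneg _)]
      refine ENNReal.ofReal_le_ofReal ?_
      have h5 := abs_sub_abs_le_abs_sub (mean ν u [])
        (whitney ε ν u (anc (vertex ε (List.ofFn v)) t))
      rw [abs_sub_comm] at h5
      linarith
    exact (ENNReal.rpow_le_rpow h2 hp0.le).trans (ENNReal.rpow_add_le_mul_rpow_add_rpow _ _ hp)
  have hI : ‖mean ν u []‖ₑ ^ p ≤ 2 ^ (p - 1) *
      ((∫⁻ t in Ioc (((0 : ℕ) : ℝ)) ((0 : ℕ) + 1),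
        ‖whitney ε ν u (anc (vertex ε (List.ofFn v)) t)‖ₑ ^ p) +
          ‖mean ν u (List.ofFn v) - mean ν u []‖ₑ ^ p) := by
    have h := setLIntegral_mono_ae' (μ := volume) measurableSet_Ioc (ae_of_all _ hpt)
    rw [lintegral_const_mul' _ _ (by simp), lintegral_add_right _ measurable_const] at h
    simpa using h
  have hW : (∫⁻ t in Ioc (((0 : ℕ) : ℝ)) ((0 : ℕ) + 1),
      ‖whitney ε ν u (anc (vertex ε (List.ofFn v)) t)‖ₑ ^ p) ≤
        ((Real.exp β).toNNReal * c : ℝ≥0) * ∫⁻ x, ‖whitney ε ν u x‖ₑ ^ p ∂mu K ε β C lam := by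
    have h := hc _ ((measurable_whitney ν u).enorm.pow_const p)
    have h1 := (ENNReal.le_tsum 0).trans h
    have h2 := (Finset.single_le_sum_of_canonicallyOrdered (Finset.mem_univ v)).trans h1
    rw [ENNReal.coe_mul, mul_assoc]
    refine le_trans (le_of_eq ?_) (mul_le_mul_right h2 _)
    rw [← mul_assoc, ← ENNReal.ofReal, ← ENNReal.ofReal_mul (Real.exp_pos _).le]
    simp [← Real.exp_add]
  have hB : ‖mean ν u (List.ofFn v) - mean ν u []‖ₑ ^ p ≤ c' * besovEnergy ε 0 lam p ν u := by
    have h1 : ν (cyl (List.ofFn v)) * ‖mean ν u (List.ofFn v) - mean ν u []‖ₑ ^ p ≤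
        besovEnergy ε 0 lam p ν u := by
      rw [besovEnergy]
      refine le_trans ?_ (ENNReal.le_tsum 0)
      have h2 := Finset.single_le_sum_of_canonicallyOrdered (Finset.mem_univ v)
        (f := fun v : Fin (0 + 1) → Fin K => ν (cyl (List.ofFn v)) *
          ‖mean ν u (List.ofFn v) - mean ν u (List.ofFn v).dropLast‖ₑ ^ p)
      simp only [hd] at h2
      refine h2.trans ?_
      simp
    calc _ ≤ (c' * ν (cyl (List.ofFn v))) *
          ‖mean ν u (List.ofFn v) - mean ν u []‖ₑ ^ p := le_mul_of_one_le_left' hc'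
      _ ≤ _ := by rw [mul_assoc]; gcongr
  refine hI.trans ?_
  rw [ENNReal.coe_mul, mul_assoc, ENNReal.coe_rpow_of_nonneg _ (by linarith),
    mul_add (_ : ℝ≥0∞) _ (besovEnergy _ _ _ _ _ _)]
  push_cast at hW ⊢
  gcongr
  · exact hW.trans (mul_le_mul_left (le_max_left _ _) _)
  · exact hB.trans (mul_le_mul_left (le_max_right _ _) _)

/-! ### Trace of the extension and comparison of the norms -/

theorem integrable_of_locallyIntegrable {ν : Measure (Boundary K)} {u : Boundary K → ℝ}
    (hu : LocallyIntegrable u ν) : Integrable u ν :=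
  integrableOn_univ.1 (hu.integrableOn_isCompact isCompact_univ)

theorem isTrace_whitney {ν : Measure (Boundary K)} [IsFiniteMeasure ν] {u : Boundary K → ℝ}
    (hu : Integrable u ν) : IsTrace ν (whitney ε ν u) u := by
  filter_upwards [ae_tendsto_mean_pre hu] with ξ hξ
  have hceil : Tendsto (fun t : ℝ => ⌈t⌉₊) atTop atTop := tendsto_nat_ceil_atTop
  have hpred : Tendsto (fun t : ℝ => ⌈t⌉₊ - 1) atTop atTop :=
    (tendsto_sub_atTop_nat 1).comp hceil
  have h1 := hξ.comp hceil
  have h2 := hξ.comp hpred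
  have h3 : Tendsto (fun t : ℝ => whitney ε ν u (ray ε ξ t) - mean ν u (pre ξ (⌈t⌉₊ - 1))) atTop
      (𝓝 0) := by
    have h4 : Tendsto (fun t : ℝ => |mean ν u (pre ξ ⌈t⌉₊) - mean ν u (pre ξ (⌈t⌉₊ - 1))|) atTop
        (𝓝 0) := by
      simpa using (h1.sub h2).abs
    refine squeeze_zero_norm' ?_ h4
    filter_upwards [eventually_gt_atTop 0] with t ht
    have hw : (ray ε ξ t).word = pre ξ ⌈t⌉₊ := by
      simp only [ray, pre, max_eq_right ht.le]
      rfl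
    have hd : (pre ξ ⌈t⌉₊).dropLast = pre ξ (⌈t⌉₊ - 1) := by
      obtain ⟨n, hn⟩ := Nat.exists_eq_succ_of_ne_zero (Nat.ceil_pos.2 ht).ne'
      rw [hn, Nat.succ_eq_add_one, dropLast_pre, Nat.add_sub_cancel]
    have h := abs_whitney_sub_le ν u (ray ε ξ t)
    rwa [hw, hd] at h
  simpa using h3.add h2

theorem eLpNorm_ofReal_eq {p : ℝ} (hp : 1 ≤ p) (ν : Measure (Boundary K)) (u : Boundary K → ℝ) :
    eLpNorm u (ENNReal.ofReal p) ν = (∫⁻ ξ, ‖u ξ‖ₑ ^ p ∂ν) ^ (1 / p) := by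
  have hp0 : 0 < p := by linarith
  rw [eLpNorm_eq_lintegral_rpow_enorm_toReal (by simpa using hp0) ENNReal.ofReal_ne_top,
    ENNReal.toReal_ofReal hp0.le]

theorem exists_newtonNorm_whitney_le (hK : 2 ≤ K) (hε : 0 < ε) {β C lam p : ℝ}
    (hβ : Real.log K < β) (hC : 0 < C) (hlam : 0 ≤ lam) (hp : 1 ≤ p)
    (hpε : ε * p = β - Real.log K)
    {ν : Measure (Boundary K)} (hν : AhlforsRegular ε (Real.log K / ε) ν) :
    ∃ A : ℝ≥0, ∀ u : Boundary K → ℝ, AEStronglyMeasurable u ν →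
      newtonNorm (mu K ε β C lam) p (whitney ε ν u) ≤ A * besovNorm ε 0 lam p ν u := by
  have hβ0 : 0 ≤ β := (Real.log_natCast_nonneg K).trans hβ.le
  have hp0 : 0 < p := by linarith
  have hp' : 0 ≤ 1 / p := by positivity
  obtain ⟨c₁, h₁⟩ := exists_lintegral_whitney_rpow_le hK hε hβ hC hlam hp hν
  obtain ⟨c₂, h₂⟩ := exists_gradEnergy_whitney_le hK hε hβ0 hC hlam hp0 hpε hν
  refine ⟨max (c₁ ^ (1 / p)) (c₂ ^ (1 / p)), fun u hu => ?_⟩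
  rw [newtonNorm, besovNorm, eLpNorm_ofReal_eq hp, mul_add]
  refine (ENNReal.rpow_add_le_add_rpow _ _ hp' ((div_le_one hp0).2 hp)).trans ?_
  refine add_le_add ((ENNReal.rpow_le_rpow (h₁ u hu) hp').trans ?_)
    ((ENNReal.rpow_le_rpow (h₂ u) hp').trans ?_)
  · rw [ENNReal.mul_rpow_of_nonneg _ _ hp', ← ENNReal.coe_rpow_of_nonneg _ hp']
    exact mul_le_mul_left (ENNReal.coe_le_coe.2 (le_max_left _ _)) _
  · rw [ENNReal.mul_rpow_of_nonneg _ _ hp', ← ENNReal.coe_rpow_of_nonneg _ hp']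
    exact mul_le_mul_left (ENNReal.coe_le_coe.2 (le_max_right _ _)) _

/-- Finiteness of the Besov norm is not assumed: the inequality yields it when the right-hand side is
finite, which is the optimality of the Besov-type space. -/
theorem exists_besovNorm_le_newtonNorm (hK : 2 ≤ K) (hε : 0 < ε) {β C lam p : ℝ}
    (hβ : Real.log K < β) (hC : 0 < C) (hp : 1 ≤ p) (hpε : ε * p = β - Real.log K)
    (hlam : (1 < p ∧ p - 1 < lam) ∨ (p = 1 ∧ 0 ≤ lam))
    {ν : Measure (Boundary K)} (hν : AhlforsRegular ε (Real.log K / ε) ν) :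
    ∃ A : ℝ≥0, ∀ u : Boundary K → ℝ, Integrable u ν →
      besovNorm ε 0 lam p ν u ≤ A * newtonNorm (mu K ε β C lam) p (whitney ε ν u) := by
  have := isFiniteMeasure_of_ahlforsRegular hK hε hν
  have hβ0 : 0 ≤ β := (Real.log_natCast_nonneg K).trans hβ.le
  have hlam0 : 0 ≤ lam := by rcases hlam with h | h <;> linarith [h.1, h.2]
  have hp0 : 0 < p := by linarith
  have hp' : 0 ≤ 1 / p := by positivity
  obtain ⟨c₁, h₁⟩ := exists_lintegral_enorm_rpow_le hp hlam ε ν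
  obtain ⟨c₂, h₂⟩ := exists_enorm_mean_nil_rpow_le hK hε hβ0 hC hlam0 hp hν
  obtain ⟨c₃, h₃⟩ := exists_besovEnergy_le_gradEnergy hK hε hβ0 hC hlam0 hp hpε hν
  refine ⟨(c₁ * (c₂ * (1 + c₃) + c₃)) ^ (1 / p) + c₃ ^ (1 / p), fun u hu => ?_⟩
  rw [newtonNorm, besovNorm, eLpNorm_ofReal_eq hp]
  set N := (∫⁻ x, ‖whitney ε ν u x‖ₑ ^ p ∂mu K ε β C lam) +
    gradEnergy (mu K ε β C lam) p (whitney ε ν u)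
  have hE : besovEnergy ε 0 lam p ν u ≤ c₃ * N := (h₃ u).trans (by gcongr; exact le_add_self)
  have hI : ∫⁻ ξ, ‖u ξ‖ₑ ^ p ∂ν ≤ (c₁ * (c₂ * (1 + c₃) + c₃) : ℝ≥0) * N := by
    refine (h₁ u hu).trans ?_
    calc _ ≤ (c₁ : ℝ≥0∞) * (c₂ * (N + c₃ * N) + c₃ * N) := by
          gcongr
          refine (h₂ u).trans ?_
          gcongr
          exact le_self_add
      _ = _ := by push_cast; ring
  rw [ENNReal.coe_add, add_mul, ENNReal.coe_rpow_of_nonneg _ hp', ENNReal.coe_rpow_of_nonneg _ hp',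
    ← ENNReal.mul_rpow_of_nonneg _ _ hp', ← ENNReal.mul_rpow_of_nonneg _ _ hp']
  exact add_le_add (ENNReal.rpow_le_rpow hI hp') (ENNReal.rpow_le_rpow hE hp')

theorem integrable_whitney_of_newtonNorm_lt_top {μ : Measure (Tree K ε)} [IsFiniteMeasure μ] {p : ℝ}
    (hp : 1 ≤ p) {ν : Measure (Boundary K)} {u : Boundary K → ℝ}
    (h : newtonNorm μ p (whitney ε ν u) < ∞) : Integrable (whitney ε ν u) μ := by
  have hp0 : 0 < p := by linarith
  have h1 : MemLp (whitney ε ν u) (ENNReal.ofReal p) μ := by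
    refine ⟨(measurable_whitney ν u).aestronglyMeasurable, ?_⟩
    rw [eLpNorm_lt_top_iff_lintegral_rpow_enorm_lt_top (by simpa using hp0) ENNReal.ofReal_ne_top,
      ENNReal.toReal_ofReal hp0.le]
    exact ((newtonNorm_lt_top hp).1 h).1
  exact h1.integrable (by simpa using hp)

theorem whitney_add {ν : Measure (Boundary K)} {f g : Boundary K →ₘ[ν] ℝ}
    (hf : LocallyIntegrable f ν) (hg : LocallyIntegrable g ν) :
    whitney ε ν (f + g : Boundary K →ₘ[ν] ℝ) = whitney ε ν f + whitney ε ν g := by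
  funext x
  simp only [whitney, Pi.add_apply, mean_congr (AEEqFun.coeFn_add f g), mean_add hf hg]
  ring

theorem whitney_smul {ν : Measure (Boundary K)} (c : ℝ) (f : Boundary K →ₘ[ν] ℝ) :
    whitney ε ν (c • f : Boundary K →ₘ[ν] ℝ) = c • whitney ε ν f := by
  funext x
  simp only [whitney, Pi.smul_apply, mean_congr (AEEqFun.coeFn_smul c f), mean_smul, smul_eq_mul]
  ring

end RegTree

end

theorem theorem1p4 (K : ℕ) (hK : 2 ≤ K) (β ε lam C p : ℝ)
    (hβ : Real.log K < β) (hε : 0 < ε)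
    (hC : max (2 * |lam| / (β - Real.log K)) (2 * Real.log 4 / ε) ≤ C)
    (hp : p = (β - Real.log K) / ε) (hp1 : 1 ≤ p)
    (hlam : (1 < p ∧ p - 1 < lam) ∨ (p = 1 ∧ 0 ≤ lam))
    (ν : Measure (RegTree.Boundary K))
    (hν : RegTree.AhlforsRegular ε (Real.log K / ε) ν) :
    -- `E` is bounded and linear from the Besov-type space to `N^{1,p}`, and `T ∘ E = Id`
    RegTree.IsBoundedLinearExtension (RegTree.mu K ε β C lam) p hp1 ν
        (RegTree.besovSpace ε 0 lam p hp1 ν).subtype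
        (fun u => RegTree.besovNorm ε 0 lam p ν u) ∧
      -- the norms of `u` and `Eu` are comparable
      (∃ A : ℝ≥0, ∀ u ∈ RegTree.besovSpace ε 0 lam p hp1 ν,
        RegTree.besovNorm ε 0 lam p ν u ≤
            A * RegTree.newtonNorm (RegTree.mu K ε β C lam) p (RegTree.whitney ε ν u) ∧
          RegTree.newtonNorm (RegTree.mu K ε β C lam) p (RegTree.whitney ε ν u) ≤
            A * RegTree.besovNorm ε 0 lam p ν u) ∧
      -- optimality: `𝕏` is a Banach space, and `ι` is its inclusion in `L^1_loc`
      ∀ (𝕏 : Type*) [NormedAddCommGroup 𝕏] [NormedSpace ℝ 𝕏] [CompleteSpace 𝕏]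
        (ι : 𝕏 →ₗ[ℝ] (RegTree.Boundary K →ₘ[ν] ℝ)),
        Function.Injective ι → (∀ f, LocallyIntegrable (ι f) ν) →
        RegTree.IsBoundedLinearExtension (RegTree.mu K ε β C lam) p hp1 ν ι
          (fun f => ‖f‖ₑ) →
        (∀ f, ι f ∈ RegTree.besovSpace ε 0 lam p hp1 ν) ∧
          ∃ A : ℝ≥0, ∀ f, RegTree.besovNorm ε 0 lam p ν (ι f) ≤ A * ‖f‖ₑ := by
  have hC0 : 0 < C := by
    have h4 : 0 < Real.log 4 := Real.log_pos (by norm_num)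
    exact (by positivity : 0 < 2 * Real.log 4 / ε).trans_le ((le_max_right _ _).trans hC)
  have hpε : ε * p = β - Real.log K := by rw [hp]; field_simp
  have hlam0 : 0 ≤ lam := by rcases hlam with h | h <;> linarith [h.1, h.2]
  have := RegTree.isFiniteMeasure_of_ahlforsRegular hK hε hν
  have := RegTree.isFiniteMeasure_mu hK hε hβ hC0 hlam0 hν
  obtain ⟨A₁, h₁⟩ := RegTree.exists_newtonNorm_whitney_le hK hε hβ hC0 hlam0 hp1 hpε hν
  obtain ⟨A₂, h₂⟩ := RegTree.exists_besovNorm_le_newtonNorm hK hε hβ hC0 hp1 hpε hlam hν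
  refine ⟨⟨⟨⟨⟨fun f => ⟨RegTree.whitney ε ν f.1, ?_⟩, ?_⟩, ?_⟩, fun f => rfl, A₁,
      fun f => h₁ _ f.1.aestronglyMeasurable⟩, fun f =>
        RegTree.isTrace_whitney (RegTree.integrable_of_locallyIntegrable f.2.1)⟩,
    ⟨max A₁ A₂, fun u hu => ⟨?_, ?_⟩⟩, ?_⟩
  · have hfin := (h₁ f.1 f.1.aestronglyMeasurable).trans_lt
      (ENNReal.mul_lt_top ENNReal.coe_lt_top f.2.2)
    exact ⟨(RegTree.integrable_whitney_of_newtonNorm_lt_top hp1 hfin).locallyIntegrable, hfin⟩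
  · exact fun f g => Subtype.ext (RegTree.whitney_add f.2.1 g.2.1)
  · exact fun c f => Subtype.ext (RegTree.whitney_smul c f.1)
  · exact (h₂ u (RegTree.integrable_of_locallyIntegrable hu.1)).trans
      (mul_le_mul_left (ENNReal.coe_le_coe.2 (le_max_right _ _)) _)
  · exact (h₁ u u.aestronglyMeasurable).trans
      (mul_le_mul_left (ENNReal.coe_le_coe.2 (le_max_left _ _)) _)
  · rintro 𝕏 _ _ _ ι - hι ⟨⟨E, hE, A, hA⟩, -⟩
    have hb : ∀ f, RegTree.besovNorm ε 0 lam p ν (ι f) ≤ (A₂ * A : ℝ≥0) * ‖f‖ₑ := fun f => by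
      refine (h₂ _ (RegTree.integrable_of_locallyIntegrable (hι f))).trans ?_
      rw [ENNReal.coe_mul, mul_assoc, ← hE f]
      exact mul_le_mul_right (hA f) _
    exact ⟨fun f => ⟨hι f, (hb f).trans_lt (ENNReal.mul_lt_top ENNReal.coe_lt_top enorm_lt_top)⟩,
      _, hb⟩
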